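/- Let $G=(V,E)$ be a finite simple graph. A matching of a subgraph $H$ of $G$ is a set $M\subseteq E(H)$ of pairwise disjoint edges; write $x\notin M$ if the vertex $x$ is not an endpoint of an edge of $M$. Given real edge weights $(w_e)_{e\in E}$ and vertex weights $(\nu_x)_{x\in V}$, let $\langle\cdot\rangle_H$ be the expectation for a random matching $\mathcal M_H$ of $H$ with the Gibbs law $$\mu_H(M)=Z_H^{-1}\exp\Big(\sum_{e\in M}w_e+\sum_{x\in V(H),\,x\notin M}\nu_x\Big).$$ In the disordered monomer-dimer model on $G$, the edge weights are i.i.d. with law $\rho_E$, the vertex weights are i.i.d. with law $\rho_V$, and the two families are independent; $\mathbf E$ is the expectation over the weights. Let $\mathrm{dist}$ be the graph distance ($\infty$ between different components, with $e^{-\infty}=0$), and let $\mathrm{dist}(e,e')$ be the least distance between an endpoint of $e$ and an endpoint of $e'$. Let $\mathbb B^x_R$ (resp. $\mathbb B^e_R$) be the subgraph of $G$ induced by the vertices at distance at most $R$ from $x$ (resp. from at least one endpoint of $e$). A supremum $\sup_{w_e,w_{e'}}$ or $\sup_{\nu_x,\nu_{x'}}$ is over all real values of the indicated weights, the other weights being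 kept. **Proposition.** Let $D\ge 0$ be an integer and let $\rho_E,\rho_V$ be probability measures on $\mathbb R$. There exist constants $c,C>0$, depending only on $D,\rho_E,\rho_V$, such that for the disordered monomer-dimer model with these weight laws on any finite graph $G$ with maximum degree at most $D$, the following hold. 1. For all edges $e,e'$ of $G$, $$\mathbf E\big|\langle \mathbf 1_{\{e\in\mathcal M_G,\,e'\in\mathcal M_G\}}\rangle_G-\langle \mathbf 1_{\{e\in\mathcal M_G\}}\rangle_G\langle \mathbf 1_{\{e'\in\mathcal M_G\}}\rangle_G\big|\le Ce^{-c\,\mathrm{dist}(e,e')}.$$ 2. For all edges $e,e'$ of $G$, $$\mathbf E\sup_{w_e,w_{e'}}\big|\langle \mathbf 1_{\{e\in\mathcal M_G,\,e'\in\mathcal M_G\}}\rangle_G-\langle \mathbf 1_{\{e\in\mathcal M_G\}}\rangle_G\langle \mathbf 1_{\{e'\in\mathcal M_G\}}\rangle_G\big|\le Ce^{-c\,\mathrm{dist}(e,e')}.$$ 3. For all vertices $x,x'$ of $G$, $$\mathbf E\sup_{\nu_x,\nu_{x'}}\big|\langle \mathbf 1_{\{x\notin\mathcal M_G,\,x'\notin\mathcal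 M_G\}}\rangle_G-\langle \mathbf 1_{\{x\notin\mathcal M_G\}}\rangle_G\langle \mathbf 1_{\{x'\notin\mathcal M_G\}}\rangle_G\big|\le Ce^{-c\,\mathrm{dist}(x,x')}.$$ 4. For every integer $R\ge1$, all edges $e,e'$ of $G$, every subgraph $H$ of $G$ containing $\mathbb B^e_R\cup\mathbb B^{e'}_R$, and all $\delta_1,\delta_2\in\{0,1\}$, $$\mathbf E\sup_{w_e,w_{e'}}\big|\mu_G(\mathbf 1_{\{e\in\mathcal M_G\}}=\delta_1,\ \mathbf 1_{\{e'\in\mathcal M_G\}}=\delta_2)-\mu_H(\mathbf 1_{\{e\in\mathcal M_H\}}=\delta_1,\ \mathbf 1_{\{e'\in\mathcal M_H\}}=\delta_2)\big|\le Ce^{-cR}.$$ 5. For every integer $R\ge1$, all vertices $x,x'$ of $G$, every subgraph $H$ of $G$ containing $\mathbb B^x_R\cup\mathbb B^{x'}_R$, and all $\delta_1,\delta_2\in\{0,1\}$, $$\mathbf E\sup_{\nu_x,\nu_{x'}}\big|\mu_G(\mathbf 1_{\{x\notin\mathcal M_G\}}=\delta_1,\ \mathbf 1_{\{x'\notin\mathcal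 M_G\}}=\delta_2)-\mu_H(\mathbf 1_{\{x\notin\mathcal M_H\}}=\delta_1,\ \mathbf 1_{\{x'\notin\mathcal M_H\}}=\delta_2)\big|\le Ce^{-cR}.$$ -/

import Mathlib

open MeasureTheory ProbabilityTheory
open scoped ENNReal

namespace MonomerDimer

noncomputable section

variable {V : Type*} [Fintype V] {G : SimpleGraph V}

/-- A (partial) matching of the subgraph `H` of `G`: a set of edges of `H`,
no two of which have a common endpoint. -/
def IsMatching (H : G.Subgraph) (M : Finset G.edgeSet) : Prop :=
  (∀ e ∈ M, (e : Sym2 V) ∈ H.edgeSet) ∧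
    ∀ e ∈ M, ∀ f ∈ M, e ≠ f → ∀ x : V, x ∈ (e : Sym2 V) → x ∉ (f : Sym2 V)

/-- The vertex `x` is not matched by `M`, written `x ∉ M` in the literature. -/
def Unmatched (x : V) (M : Finset G.edgeSet) : Prop :=
  ∀ e ∈ M, x ∉ (e : Sym2 V)

open Classical in
/-- The finite set of all matchings of `H`. -/
def matchings (H : G.Subgraph) : Finset (Finset G.edgeSet) :=
  Finset.univ.filter fun M => IsMatching H M

theorem mem_matchings (H : G.Subgraph) (M : Finset G.edgeSet) :
    M ∈ matchings H ↔ IsMatching H M := by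
  classical
  unfold matchings
  rw [Finset.mem_filter]
  exact and_iff_right (Finset.mem_univ _)

open Classical in
/-- The Boltzmann weight `exp (∑_{e ∈ M} w_e + ∑_{x ∈ V(H), x ∉ M} ν_x)` of `M` in `H`. -/
def boltzmann (H : G.Subgraph) (w : G.edgeSet → ℝ) (ν : V → ℝ) (M : Finset G.edgeSet) : ℝ :=
  Real.exp (∑ e ∈ M, w e + ∑ x with x ∈ H.verts ∧ Unmatched x M, ν x)

/-- The partition function of the monomer-dimer model on `H`. -/
def partitionFunction (H : G.Subgraph) (w : G.edgeSet → ℝ) (ν : V → ℝ) : ℝ :=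
  ∑ M ∈ matchings H, boltzmann H w ν M

/-- The expectation of `f` of a random matching of `H` under the Gibbs measure
`μ_H(M) = boltzmann M / Z_H`, for fixed weights. -/
def gibbsExp (H : G.Subgraph) (w : G.edgeSet → ℝ) (ν : V → ℝ)
    (f : Finset G.edgeSet → ℝ) : ℝ :=
  ∑ M ∈ matchings H, boltzmann H w ν M / partitionFunction H w ν * f M

/-- The Gibbs probability `⟨1_S⟩` of an event `S`. -/
def gibbsProb (H : G.Subgraph) (w : G.edgeSet → ℝ) (ν : V → ℝ)
    (S : Set (Finset G.edgeSet)) : ℝ :=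
  gibbsExp H w ν (S.indicator 1)

/-- Gibbs covariance on `G` of the indicators of `e ∈ M` and `e' ∈ M`. -/
def edgeCov (e e' : G.edgeSet) (w : G.edgeSet → ℝ) (ν : V → ℝ) : ℝ :=
  gibbsProb (⊤ : G.Subgraph) w ν {M | e ∈ M ∧ e' ∈ M} -
    gibbsProb (⊤ : G.Subgraph) w ν {M | e ∈ M} * gibbsProb (⊤ : G.Subgraph) w ν {M | e' ∈ M}

/-- Gibbs covariance on `G` of the indicators of `x ∉ M` and `x' ∉ M`. -/
def vertexCov (x x' : V) (w : G.edgeSet → ℝ) (ν : V → ℝ) : ℝ :=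
  gibbsProb (⊤ : G.Subgraph) w ν {M | Unmatched x M ∧ Unmatched x' M} -
    gibbsProb (⊤ : G.Subgraph) w ν {M | Unmatched x M} *
      gibbsProb (⊤ : G.Subgraph) w ν {M | Unmatched x' M}

/-- The event that the indicators of `e ∈ M` and `e' ∈ M` have the values `δ₁` and `δ₂`. -/
def edgeEvent (e e' : G.edgeSet) (δ₁ δ₂ : Bool) : Set (Finset G.edgeSet) :=
  {M | (e ∈ M ↔ δ₁ = true) ∧ (e' ∈ M ↔ δ₂ = true)}

/-- The event that the indicators of `x ∉ M` and `x' ∉ M` have the values `δ₁` and `δ₂`. -/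
def vertexEvent (x x' : V) (δ₁ δ₂ : Bool) : Set (Finset G.edgeSet) :=
  {M | (Unmatched x M ↔ δ₁ = true) ∧ (Unmatched x' M ↔ δ₂ = true)}

end

noncomputable section

variable {V : Type*} {G : SimpleGraph V}

/-- The subgraph of `G` induced by the vertices at distance at most `R` from `x`. -/
def vertexBall (x : V) (R : ℕ) : G.Subgraph :=
  (⊤ : G.Subgraph).induce {y | G.edist x y ≤ R}

/-- The subgraph of `G` induced by the vertices at distance at most `R` from an endpoint of `e`. -/
def edgeBall (e : G.edgeSet) (R : ℕ) : G.Subgraph :=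
  (⊤ : G.Subgraph).induce {y | ∃ x ∈ (e : Sym2 V), G.edist x y ≤ R}

/-- The graph distance between two edges: the least distance between their endpoints
(infinite if they lie in different components). -/
def edgeDist (e e' : G.edgeSet) : ℕ∞ :=
  ⨅ x ∈ (e : Sym2 V), ⨅ y ∈ (e' : Sym2 V), G.edist x y

/-- `exp (-c * d)` for an extended distance `d`, with `exp (-∞) = 0`. -/
def expDecay (c : ℝ) : ℕ∞ → ℝ
  | ⊤ => 0
  | (n : ℕ) => Real.exp (-c * n)

open Classical in
/-- The supremum of `|F|` when the `i`-th and the `j`-th weight run over all real values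
and the other weights are kept. -/
def supTwo {ι : Type*} (F : (ι → ℝ) → ℝ) (i j : ι) (u : ι → ℝ) : ℝ≥0∞ :=
  ⨆ s : ℝ, ⨆ t : ℝ, ENNReal.ofReal |F (Function.update (Function.update u i s) j t)|

/-- The expectation of the nonnegative random variable `X` is well defined and at most `b`. -/
def ExpectationLE {Ω : Type*} [MeasurableSpace Ω] (P : Measure Ω) (X : Ω → ℝ≥0∞) (b : ℝ) : Prop :=
  AEMeasurable X P ∧ ∫⁻ ω, X ω ∂P ≤ ENNReal.ofReal b

/-- The random weights of the disordered model on `G`: the edge weights all have law `ρE`,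
the vertex weights all have law `ρV`, and the whole family of edge and vertex weights
is independent. -/
structure IsDisorder {Ω : Type*} [MeasurableSpace Ω] (P : Measure Ω) (G : SimpleGraph V)
    (ρE ρV : Measure ℝ) (w : G.edgeSet → Ω → ℝ) (ν : V → Ω → ℝ) : Prop where
  law_edge : ∀ e, HasLaw (w e) ρE P
  law_vertex : ∀ x, HasLaw (ν x) ρV P
  indep : iIndepFun (fun i : G.edgeSet ⊕ V => Sum.elim w ν i) P

end

end MonomerDimer

/-! Factoring out the total vertex weight turns the Gibbs law into a matching measure with edge
activities a(xy) = exp(w(xy) - ν(x) - ν(y)) (`gibbsProb_eq`). Write p_F(x) for the probability that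
x is unmatched when the edge set is F. Then p_F(x) = 1 / (1 + ∑ a(xy) p_{F-x}(y)), the sum being
over the edges xy of F, and iterating this explores the self-avoiding walks from x. In logarithms
one step is Lipschitz with constant S / (1 + S), where S is the total activity at x: it never
expands, and it contracts by Λ / (1 + Λ) wherever S ≤ Λ. If every walk of length n from x meets m +
1 such vertices, edges at distance n or more change log p_F(x) by at most log(1 + Λ) (Λ / (1 + Λ))^m
(`abs_log_monomerProb_sub_le_pow`).

The weights need no moments: tightness gives K with P(|weight| > K) ≤ ε, and a vertex is good when
all weights near it are at most K in absolute value. A weight is near at most D + 2 vertices, so a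
walk of length 2(D + 2)m with few good vertices sees about m large weights. By independence this
costs about ε^m, which for small ε beats the exponential number of choices of a walk and of weights
on it (`measure_failEvent_le`). The two weights under the supremum are counted as large whatever
their values, so the estimate is uniform in them.

Finally, conditioning on one event deletes a vertex or an edge with its neighbours. A covariance
thus becomes a difference of probabilities for two edge sets that agree near the other vertex or
edge, and so does the comparison of G with H. An edge has probability a r / (1 + a r), with r a
product of two monomer probabilities, and this is 1-Lipschitz in log r uniformly in a. -/

namespace MonomerDimer

noncomputable section

/-! ### Matching polynomials, their recursions and conditioning -/

section Algebra

open scoped Classical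

variable {V : Type*} {G : SimpleGraph V}

/-- The matchings contained in the finite edge set `F`. -/
def matchingsIn (F : Finset G.edgeSet) : Finset (Finset G.edgeSet) :=
  F.powerset.filter fun M =>
    ∀ e ∈ M, ∀ f ∈ M, e ≠ f → ∀ x : V, x ∈ (e : Sym2 V) → x ∉ (f : Sym2 V)

/-- The edges of `F` that do not contain the vertex `x`. -/
def avoidVertex (F : Finset G.edgeSet) (x : V) : Finset G.edgeSet :=
  F.filter fun e => x ∉ (e : Sym2 V)

/-- The edges of `F` that are disjoint from the edge `e`. -/
def avoidEdge (F : Finset G.edgeSet) (e : G.edgeSet) : Finset G.edgeSet :=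
  F.filter fun f => ∀ x : V, x ∈ (e : Sym2 V) → x ∉ (f : Sym2 V)

/-- The matching polynomial of the edge set `F` with edge activities `a`. -/
def matchingSum (a : G.edgeSet → ℝ) (F : Finset G.edgeSet) : ℝ :=
  ∑ M ∈ matchingsIn F, ∏ e ∈ M, a e

/-- The probability of `S` for the matching of `F` with edge activities `a`. -/
def matchingProb (a : G.edgeSet → ℝ) (F : Finset G.edgeSet) (S : Set (Finset G.edgeSet)) : ℝ :=
  (∑ M ∈ matchingsIn F, S.indicator (fun M => ∏ e ∈ M, a e) M) / matchingSum a F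

/-- The probability that the vertex `x` is not matched. -/
def monomerProb (a : G.edgeSet → ℝ) (F : Finset G.edgeSet) (x : V) : ℝ :=
  matchingSum a (avoidVertex F x) / matchingSum a F

theorem mem_matchingsIn {F M : Finset G.edgeSet} :
    M ∈ matchingsIn F ↔ M ⊆ F ∧
      ∀ e ∈ M, ∀ f ∈ M, e ≠ f → ∀ x : V, x ∈ (e : Sym2 V) → x ∉ (f : Sym2 V) := by
  simp [matchingsIn]

theorem mem_avoidVertex {F : Finset G.edgeSet} {x : V} {e : G.edgeSet} :
    e ∈ avoidVertex F x ↔ e ∈ F ∧ x ∉ (e : Sym2 V) := by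
  simp [avoidVertex]

theorem mem_avoidEdge {F : Finset G.edgeSet} {e f : G.edgeSet} :
    f ∈ avoidEdge F e ↔ f ∈ F ∧ ∀ x : V, x ∈ (e : Sym2 V) → x ∉ (f : Sym2 V) := by
  simp [avoidEdge]

theorem notMem_avoidEdge_self (F : Finset G.edgeSet) (e : G.edgeSet) : e ∉ avoidEdge F e := by
  intro h
  have := (mem_avoidEdge.1 h).2 _ (Sym2.out_fst_mem (e : Sym2 V))
  exact this (Sym2.out_fst_mem _)

theorem avoidEdge_eq {F : Finset G.edgeSet} {e : G.edgeSet} {x y : V}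
    (he : (e : Sym2 V) = s(x, y)) : avoidEdge F e = avoidVertex (avoidVertex F x) y := by
  ext f
  simp only [mem_avoidEdge, mem_avoidVertex, he, Sym2.mem_iff]
  constructor
  · rintro ⟨h, h'⟩
    exact ⟨⟨h, h' x (Or.inl rfl)⟩, h' y (Or.inr rfl)⟩
  · rintro ⟨⟨h, h1⟩, h2⟩
    refine ⟨h, ?_⟩
    rintro z (rfl | rfl) <;> assumption

theorem avoidEdge_erase (F : Finset G.edgeSet) (e : G.edgeSet) :
    avoidEdge (F.erase e) e = avoidEdge F e := by
  ext f
  simp only [mem_avoidEdge, Finset.mem_erase]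
  constructor
  · rintro ⟨⟨_, h⟩, h'⟩
    exact ⟨h, h'⟩
  · rintro ⟨h, h'⟩
    refine ⟨⟨?_, h⟩, h'⟩
    rintro rfl
    exact notMem_avoidEdge_self F f (mem_avoidEdge.2 ⟨h, h'⟩)

theorem matchingsIn_filter_unmatched (F : Finset G.edgeSet) (x : V) :
    (matchingsIn F).filter (fun M => Unmatched x M) = matchingsIn (avoidVertex F x) := by
  ext M
  simp only [Finset.mem_filter, mem_matchingsIn, Finset.subset_iff, mem_avoidVertex]
  constructor
  · rintro ⟨⟨h1, h2⟩, h3⟩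
    exact ⟨fun e he => ⟨h1 he, h3 e he⟩, h2⟩
  · rintro ⟨h1, h2⟩
    exact ⟨⟨fun e he => (h1 he).1, h2⟩, fun e he => (h1 he).2⟩

theorem matchingsIn_filter_notMem (F : Finset G.edgeSet) (e : G.edgeSet) :
    (matchingsIn F).filter (fun M => e ∉ M) = matchingsIn (F.erase e) := by
  ext M
  simp only [Finset.mem_filter, mem_matchingsIn, Finset.subset_iff, Finset.mem_erase]
  constructor
  · rintro ⟨⟨h1, h2⟩, h3⟩
    exact ⟨fun f hf => ⟨by rintro rfl; exact h3 hf, h1 hf⟩, h2⟩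
  · rintro ⟨h1, h2⟩
    exact ⟨⟨fun f hf => (h1 hf).2, h2⟩, fun h => (h1 h).1 rfl⟩

theorem insert_mem_matchingsIn {F : Finset G.edgeSet} {e : G.edgeSet} (he : e ∈ F)
    {M : Finset G.edgeSet} (hM : M ∈ matchingsIn (avoidEdge F e)) :
    insert e M ∈ matchingsIn F := by
  rw [mem_matchingsIn] at hM ⊢
  obtain ⟨h1, h2⟩ := hM
  have h1' : ∀ f ∈ M, f ∈ F ∧ ∀ x : V, x ∈ (e : Sym2 V) → x ∉ (f : Sym2 V) :=
    fun f hf => mem_avoidEdge.1 (h1 hf)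
  refine ⟨Finset.insert_subset he fun f hf => (h1' f hf).1, ?_⟩
  intro f hf g hg hfg x hxf hxg
  rcases Finset.mem_insert.1 hf with hf | hf <;> rcases Finset.mem_insert.1 hg with hg | hg
  · exact hfg (hf.trans hg.symm)
  · exact (h1' g hg).2 x (hf ▸ hxf) hxg
  · exact (h1' f hf).2 x (hg ▸ hxg) hxf
  · exact h2 f hf g hg hfg x hxf hxg

theorem sum_matchingsIn_mem {F : Finset G.edgeSet} {e : G.edgeSet} (he : e ∈ F)
    (g : Finset G.edgeSet → ℝ) :
    ∑ M ∈ (matchingsIn F).filter (fun M => e ∈ M), g M =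
      ∑ M ∈ matchingsIn (avoidEdge F e), g (insert e M) := by
  have key : ∀ M ∈ matchingsIn (avoidEdge F e), e ∉ M := fun M hM h =>
    notMem_avoidEdge_self F e ((mem_matchingsIn.1 hM).1 h)
  refine Finset.sum_bij' (fun M _ => M.erase e) (fun M _ => insert e M) ?_ ?_ ?_ ?_ ?_
  · intro M hM
    obtain ⟨hM, heM⟩ := Finset.mem_filter.1 hM
    obtain ⟨h1, h2⟩ := mem_matchingsIn.1 hM
    refine mem_matchingsIn.2 ⟨fun f hf => ?_, fun f hf g hg => ?_⟩
    · obtain ⟨hne, hf⟩ := Finset.mem_erase.1 hf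
      exact mem_avoidEdge.2 ⟨h1 hf, h2 e heM f hf hne.symm⟩
    · exact h2 f (Finset.mem_of_mem_erase hf) g (Finset.mem_of_mem_erase hg)
  · intro M hM
    exact Finset.mem_filter.2 ⟨insert_mem_matchingsIn he hM, Finset.mem_insert_self _ _⟩
  · intro M hM
    exact Finset.insert_erase (Finset.mem_filter.1 hM).2
  · intro M hM
    exact Finset.erase_insert (key M hM)
  · intro M hM
    rw [Finset.insert_erase (Finset.mem_filter.1 hM).2]

theorem sum_prod_matchingsIn_mem (a : G.edgeSet → ℝ) {F : Finset G.edgeSet} {e : G.edgeSet}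
    (he : e ∈ F) :
    ∑ M ∈ (matchingsIn F).filter (fun M => e ∈ M), ∏ f ∈ M, a f =
      a e * matchingSum a (avoidEdge F e) := by
  rw [sum_matchingsIn_mem he, matchingSum, Finset.mul_sum]
  refine Finset.sum_congr rfl fun M hM => ?_
  rw [Finset.prod_insert fun h => notMem_avoidEdge_self F e ((mem_matchingsIn.1 hM).1 h)]

theorem matchingSum_eq_erase (a : G.edgeSet → ℝ) {F : Finset G.edgeSet} {e : G.edgeSet}
    (he : e ∈ F) :
    matchingSum a F = matchingSum a (F.erase e) + a e * matchingSum a (avoidEdge F e) := by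
  rw [← sum_prod_matchingsIn_mem a he, matchingSum, matchingSum, ← matchingsIn_filter_notMem,
    add_comm, Finset.sum_filter_add_sum_filter_not]

/-- A matching covers `x` by exactly one edge or not at all, so after exchanging the sums each
matching is counted once. -/
theorem matchingSum_eq_vertex (a : G.edgeSet → ℝ) (F : Finset G.edgeSet) (x : V) :
    matchingSum a F = matchingSum a (avoidVertex F x) +
      ∑ e ∈ F.filter (fun e : G.edgeSet => x ∈ (e : Sym2 V)), a e * matchingSum a (avoidEdge F e) := by
  have h1 : ∀ e ∈ F.filter (fun e : G.edgeSet => x ∈ (e : Sym2 V)),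
      a e * matchingSum a (avoidEdge F e) =
        ∑ M ∈ matchingsIn F, if e ∈ M then ∏ f ∈ M, a f else 0 := by
    intro e he
    rw [← sum_prod_matchingsIn_mem a (Finset.mem_filter.1 he).1, Finset.sum_filter]
  rw [Finset.sum_congr rfl h1, Finset.sum_comm, matchingSum, matchingSum,
    ← matchingsIn_filter_unmatched, Finset.sum_filter, ← Finset.sum_add_distrib]
  refine Finset.sum_congr rfl fun M hM => ?_
  obtain ⟨hMF, hdis⟩ := mem_matchingsIn.1 hM
  by_cases hx : Unmatched x M
  · rw [if_pos hx, Finset.sum_eq_zero, add_zero]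
    intro e he
    rw [if_neg fun h => hx e h (Finset.mem_filter.1 he).2]
  · rw [if_neg hx, zero_add]
    simp only [Unmatched, not_forall, not_not] at hx
    obtain ⟨e, heM, hxe⟩ := hx
    rw [Finset.sum_eq_single_of_mem e (Finset.mem_filter.2 ⟨hMF heM, hxe⟩), if_pos heM]
    intro f hf hne
    rw [if_neg fun hfM => hdis e heM f hfM hne.symm x hxe (Finset.mem_filter.1 hf).2]

variable {a : G.edgeSet → ℝ}

theorem matchingSum_pos (ha : ∀ e, 0 < a e) (F : Finset G.edgeSet) : 0 < matchingSum a F := by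
  refine Finset.sum_pos (fun M _ => Finset.prod_pos fun e _ => ha e) ⟨∅, ?_⟩
  simp [mem_matchingsIn]

theorem matchingSum_mono (ha : ∀ e, 0 < a e) {F F' : Finset G.edgeSet} (h : F ⊆ F') :
    matchingSum a F ≤ matchingSum a F' := by
  refine Finset.sum_le_sum_of_subset_of_nonneg ?_ fun M _ _ =>
    Finset.prod_nonneg fun e _ => (ha e).le
  intro M hM
  obtain ⟨h1, h2⟩ := mem_matchingsIn.1 hM
  exact mem_matchingsIn.2 ⟨h1.trans h, h2⟩

theorem monomerProb_pos (ha : ∀ e, 0 < a e) (F : Finset G.edgeSet) (x : V) :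
    0 < monomerProb a F x :=
  div_pos (matchingSum_pos ha _) (matchingSum_pos ha _)

theorem monomerProb_le_one (ha : ∀ e, 0 < a e) (F : Finset G.edgeSet) (x : V) :
    monomerProb a F x ≤ 1 :=
  div_le_one_of_le₀ (matchingSum_mono ha (Finset.filter_subset _ _)) (matchingSum_pos ha _).le

/-- The recursion for monomer probabilities; the summand is
`a e * monomerProb a (avoidVertex F x) y` when `e = s(x, y)`. -/
theorem monomerProb_eq (ha : ∀ e, 0 < a e) (F : Finset G.edgeSet) (x : V) :
    monomerProb a F x = (1 + ∑ e ∈ F.filter (fun e : G.edgeSet => x ∈ (e : Sym2 V)),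
      a e * (matchingSum a (avoidEdge F e) / matchingSum a (avoidVertex F x)))⁻¹ := by
  have h := matchingSum_pos ha (avoidVertex F x)
  rw [monomerProb, ← inv_div, inv_inj, matchingSum_eq_vertex a F x, add_div, div_self h.ne',
    Finset.sum_div]
  simp only [mul_div_assoc]

theorem matchingSum_avoidEdge_div {F : Finset G.edgeSet} {e : G.edgeSet} {x y : V}
    (he : (e : Sym2 V) = s(x, y)) :
    matchingSum a (avoidEdge F e) / matchingSum a (avoidVertex F x) =
      monomerProb a (avoidVertex F x) y := by
  rw [avoidEdge_eq he, monomerProb]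

theorem matchingProb_nonneg (ha : ∀ e, 0 < a e) (F : Finset G.edgeSet)
    (S : Set (Finset G.edgeSet)) : 0 ≤ matchingProb a F S :=
  div_nonneg (Finset.sum_nonneg fun _ _ => Set.indicator_nonneg
    (fun _ _ => Finset.prod_nonneg fun e _ => (ha e).le) _) (matchingSum_pos ha _).le

theorem matchingProb_le_one (ha : ∀ e, 0 < a e) (F : Finset G.edgeSet)
    (S : Set (Finset G.edgeSet)) : matchingProb a F S ≤ 1 :=
  div_le_one_of_le₀ (Finset.sum_le_sum fun _ _ => Set.indicator_le_self'
    (fun _ _ => Finset.prod_nonneg fun e _ => (ha e).le) _) (matchingSum_pos ha _).le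

theorem matchingProb_inter_add_diff (F : Finset G.edgeSet) (S T : Set (Finset G.edgeSet)) :
    matchingProb a F (S ∩ T) + matchingProb a F (S \ T) = matchingProb a F S := by
  rw [matchingProb, matchingProb, matchingProb, ← add_div]
  congr 1
  rw [← Finset.sum_add_distrib]
  refine Finset.sum_congr rfl fun M _ => ?_
  by_cases h1 : M ∈ S <;> by_cases h2 : M ∈ T <;> simp [h1, h2]

theorem matchingProb_univ (ha : ∀ e, 0 < a e) (F : Finset G.edgeSet) :
    matchingProb a F Set.univ = 1 := by
  simp only [matchingProb, Set.indicator_univ]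
  exact div_self (matchingSum_pos ha F).ne'

theorem matchingProb_unmatched (F : Finset G.edgeSet) (x : V) :
    matchingProb a F {M | Unmatched x M} = monomerProb a F x := by
  rw [matchingProb, monomerProb, matchingSum.eq_1 a (avoidVertex F x),
    ← matchingsIn_filter_unmatched, Finset.sum_filter]
  congr 1

/-- Given that `x` is unmatched, the matching is a random matching of `avoidVertex F x`. Hence the
covariance of two monomers compares `F` with `avoidVertex F x` at `y`. -/
theorem matchingProb_unmatched_inter (ha : ∀ e, 0 < a e) (F : Finset G.edgeSet) (x y : V) :
    matchingProb a F ({M | Unmatched x M} ∩ {M | Unmatched y M}) =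
      monomerProb a F x * monomerProb a (avoidVertex F x) y := by
  have h : matchingProb a F ({M | Unmatched x M} ∩ {M | Unmatched y M}) =
      matchingSum a (avoidVertex (avoidVertex F x) y) / matchingSum a F := by
    rw [matchingProb, matchingSum.eq_1 a (avoidVertex _ y), ← matchingsIn_filter_unmatched,
      ← matchingsIn_filter_unmatched, Finset.filter_filter, Finset.sum_filter]
    congr 1
    refine Finset.sum_congr rfl fun M _ => ?_
    by_cases h1 : Unmatched x M <;> by_cases h2 : Unmatched y M <;> simp [h1, h2]
  rw [h, monomerProb, monomerProb, mul_comm, div_mul_div_cancel₀ (matchingSum_pos ha _).ne']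

theorem matchingProb_mem {F : Finset G.edgeSet} {e : G.edgeSet} (he : e ∈ F) :
    matchingProb a F {M | e ∈ M} = a e * matchingSum a (avoidEdge F e) / matchingSum a F := by
  rw [← sum_prod_matchingsIn_mem a he, Finset.sum_filter, matchingProb]
  congr 1
  refine Finset.sum_congr rfl fun M _ => ?_
  by_cases h : e ∈ M <;> simp [h]

/-- Given `e`, the remaining edges form a random matching of `avoidEdge F e`. -/
theorem matchingProb_mem_inter (ha : ∀ e, 0 < a e) {F : Finset G.edgeSet} {e f : G.edgeSet}
    (he : e ∈ F) (hf : f ∈ avoidEdge F e) :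
    matchingProb a F ({M | e ∈ M} ∩ {M | f ∈ M}) =
      matchingProb a F {M | e ∈ M} * matchingProb a (avoidEdge F e) {M | f ∈ M} := by
  have hne : f ≠ e := by
    rintro rfl
    exact notMem_avoidEdge_self F f hf
  have h : matchingProb a F ({M | e ∈ M} ∩ {M | f ∈ M}) =
      a e * (a f * matchingSum a (avoidEdge (avoidEdge F e) f)) / matchingSum a F := by
    rw [matchingProb, ← sum_prod_matchingsIn_mem a hf, Finset.mul_sum]
    congr 1
    have h : ∀ M ∈ matchingsIn F,
        ({M | e ∈ M} ∩ {M | f ∈ M} : Set (Finset G.edgeSet)).indicator (fun M => ∏ e ∈ M, a e) M =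
          if e ∈ M then (if f ∈ M then ∏ e ∈ M, a e else 0) else 0 := by
      intro M _
      by_cases h1 : e ∈ M <;> by_cases h2 : f ∈ M <;> simp [h1, h2]
    rw [Finset.sum_congr rfl h, ← Finset.sum_filter, sum_matchingsIn_mem he, Finset.sum_filter]
    refine Finset.sum_congr rfl fun M hM => ?_
    rw [Finset.prod_insert fun h => notMem_avoidEdge_self F e ((mem_matchingsIn.1 hM).1 h)]
    by_cases h : f ∈ M <;> simp [h, hne]
  rw [h, matchingProb_mem he, matchingProb_mem hf]
  have := (matchingSum_pos ha (avoidEdge F e)).ne'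
  have := (matchingSum_pos ha F).ne'
  field_simp

theorem matchingProb_mem_inter_eq_zero {F : Finset G.edgeSet} {e f : G.edgeSet} (hne : e ≠ f)
    {x : V} (hxe : x ∈ (e : Sym2 V)) (hxf : x ∈ (f : Sym2 V)) :
    matchingProb a F ({M | e ∈ M} ∩ {M | f ∈ M}) = 0 := by
  rw [matchingProb, Finset.sum_eq_zero, zero_div]
  intro M hM
  refine Set.indicator_of_notMem ?_ _
  rintro ⟨heM, hfM⟩
  exact absurd hxf ((mem_matchingsIn.1 hM).2 e heM f hfM hne x hxe)

/-- The edge probability as a function of the edge activity. -/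
theorem matchingProb_mem_eq (ha : ∀ e, 0 < a e) {F : Finset G.edgeSet} {e : G.edgeSet}
    (he : e ∈ F) {x y : V} (hxy : (e : Sym2 V) = s(x, y)) :
    matchingProb a F {M | e ∈ M} = a e * (monomerProb a (F.erase e) x *
        monomerProb a (avoidVertex (F.erase e) x) y) /
      (1 + a e * (monomerProb a (F.erase e) x * monomerProb a (avoidVertex (F.erase e) x) y)) := by
  have h1 : monomerProb a (F.erase e) x * monomerProb a (avoidVertex (F.erase e) x) y =
      matchingSum a (avoidEdge F e) / matchingSum a (F.erase e) := by
    rw [monomerProb, monomerProb, mul_comm, div_mul_div_cancel₀ (matchingSum_pos ha _).ne',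
      ← avoidEdge_eq hxy, avoidEdge_erase]
  have h2 := matchingSum_pos ha (F.erase e)
  have h3 := matchingSum_pos ha F
  rw [h1, matchingProb_mem he, matchingSum_eq_erase a he]
  rw [matchingSum_eq_erase a he] at h3
  have h4 : 1 + a e * (matchingSum a (avoidEdge F e) / matchingSum a (F.erase e)) =
      (matchingSum a (F.erase e) + a e * matchingSum a (avoidEdge F e)) /
        matchingSum a (F.erase e) := by
    field_simp
  rw [h4]
  field_simp

end Algebra

end

end MonomerDimer

namespace MonomerDimer

noncomputable section

/-! ### Contraction of the recursion in logarithmic scale -/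

section Contraction

/-- With t = S' / (1 + S'), convexity of exp gives e^(-tm) ≤ 1 - t + t e^(-m), and (1 + S') times
the right side is 1 + e^(-m) S' ≤ 1 + S. Moreover t ≤ Λ / (1 + Λ). -/
theorem one_add_mul_exp_le {S S' Λ m : ℝ} (hS' : 0 ≤ S') (hΛ : S' ≤ Λ) (hm : 0 ≤ m)
    (h : S' ≤ Real.exp m * S) : 1 + S' ≤ Real.exp (Λ / (1 + Λ) * m) * (1 + S) := by
  set t := S' / (1 + S') with ht
  have h1 : 0 < 1 + S' := by linarith
  have ht0 : 0 ≤ t := by positivity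
  have ht1 : t ≤ 1 := by
    rw [ht, div_le_one h1]
    linarith
  have htΛ : t ≤ Λ / (1 + Λ) := by
    rw [ht, div_le_div_iff₀ h1 (by linarith)]
    nlinarith
  have hconv : Real.exp (-(t * m)) ≤ (1 - t) + t * Real.exp (-m) := by
    have := convexOn_exp.2 (Set.mem_univ (0 : ℝ)) (Set.mem_univ (-m)) (sub_nonneg.2 ht1) ht0
      (by ring)
    simpa using this
  have hS : Real.exp (-m) * S' ≤ S := by
    have := mul_le_mul_of_nonneg_left h (Real.exp_pos (-m)).le
    rwa [← mul_assoc, ← Real.exp_add, neg_add_cancel, Real.exp_zero, one_mul] at this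
  have h2 : (1 + S') * ((1 - t) + t * Real.exp (-m)) = 1 + Real.exp (-m) * S' := by
    have : (1 + S') * t = S' := by
      rw [ht]
      field_simp
    linear_combination (Real.exp (-m) - 1) * this
  have h3 : (1 + S') * Real.exp (-(t * m)) ≤ 1 + S := by
    refine (mul_le_mul_of_nonneg_left hconv h1.le).trans ?_
    rw [h2]
    linarith
  have h4 : 1 + S' ≤ Real.exp (t * m) * (1 + S) := by
    have := mul_le_mul_of_nonneg_left h3 (Real.exp_pos (t * m)).le
    rwa [mul_left_comm, ← Real.exp_add, add_neg_cancel, Real.exp_zero, mul_one] at this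
  refine h4.trans (mul_le_mul_of_nonneg_right ?_ ?_)
  · exact Real.exp_le_exp.2 (mul_le_mul_of_nonneg_right htΛ hm)
  · exact (by positivity : 0 ≤ (1 + S') * Real.exp (-(t * m))).trans h3

theorem log_one_add_sum_le {ι : Type*} {s : Finset ι} {a q q' : ι → ℝ} {Λ m : ℝ}
    (ha : ∀ i, 0 ≤ a i) (hq : ∀ i ∈ s, 0 < q i) (hq' : ∀ i ∈ s, 0 < q' i ∧ q' i ≤ 1)
    (hΛ : ∑ i ∈ s, a i ≤ Λ) (hm : 0 ≤ m)
    (h : ∀ i ∈ s, |Real.log (q i) - Real.log (q' i)| ≤ m) :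
    Real.log (1 + ∑ i ∈ s, a i * q' i) - Real.log (1 + ∑ i ∈ s, a i * q i) ≤
      Λ / (1 + Λ) * m := by
  have hS : 0 ≤ ∑ i ∈ s, a i * q i :=
    Finset.sum_nonneg fun i hi => mul_nonneg (ha i) (hq i hi).le
  have hS' : 0 ≤ ∑ i ∈ s, a i * q' i :=
    Finset.sum_nonneg fun i hi => mul_nonneg (ha i) (hq' i hi).1.le
  have key := one_add_mul_exp_le (S := ∑ i ∈ s, a i * q i) (Λ := Λ) hS'
    ((Finset.sum_le_sum fun i hi => mul_le_of_le_one_right (ha i) (hq' i hi).2).trans hΛ) hm (by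
      rw [Finset.mul_sum]
      refine Finset.sum_le_sum fun i hi => ?_
      rw [mul_left_comm]
      refine mul_le_mul_of_nonneg_left ?_ (ha i)
      rw [← Real.exp_log (hq i hi), ← Real.exp_add, ← Real.log_le_iff_le_exp (hq' i hi).1]
      linarith [(abs_le.1 (h i hi)).1])
  have := Real.log_le_log (by linarith) key
  rw [Real.log_mul (Real.exp_pos _).ne' (by linarith), Real.log_exp] at this
  linarith

/-- One step of `monomerProb_eq`, read as a map on logarithms of probabilities. -/
theorem abs_log_inv_one_add_sum_le {ι : Type*} {s : Finset ι} {a q q' : ι → ℝ} {Λ m : ℝ}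
    (ha : ∀ i, 0 ≤ a i) (hq : ∀ i ∈ s, 0 < q i ∧ q i ≤ 1) (hq' : ∀ i ∈ s, 0 < q' i ∧ q' i ≤ 1)
    (hΛ : ∑ i ∈ s, a i ≤ Λ) (hm : 0 ≤ m)
    (h : ∀ i ∈ s, |Real.log (q i) - Real.log (q' i)| ≤ m) :
    |Real.log (1 + ∑ i ∈ s, a i * q i)⁻¹ - Real.log (1 + ∑ i ∈ s, a i * q' i)⁻¹| ≤
      Λ / (1 + Λ) * m := by
  have h1 := log_one_add_sum_le ha (fun i hi => (hq i hi).1) hq' hΛ hm h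
  have h2 := log_one_add_sum_le ha (fun i hi => (hq' i hi).1) hq hΛ hm fun i hi => by
    rw [abs_sub_comm]
    exact h i hi
  rw [Real.log_inv, Real.log_inv, abs_le]
  constructor <;> linarith

theorem abs_sub_le_abs_log_sub {p q : ℝ} (hp : 0 < p) (hp1 : p ≤ 1) (hq : 0 < q) (hq1 : q ≤ 1) :
    |p - q| ≤ |Real.log p - Real.log q| := by
  wlog h : q ≤ p generalizing p q
  · rw [abs_sub_comm, abs_sub_comm (Real.log p)]
    exact this hq hq1 hp hp1 (le_of_not_ge h)
  rw [abs_of_nonneg (sub_nonneg.2 h)]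
  refine le_trans ?_ (le_abs_self _)
  have h1 := Real.add_one_le_exp (Real.log q - Real.log p)
  rw [Real.exp_sub, Real.exp_log hp, Real.exp_log hq, le_div_iff₀ hp] at h1
  have h2 : Real.log q ≤ Real.log p := Real.log_le_log hq h
  nlinarith

/-- For r' ≤ r the difference is at most (cr - cr') / (cr) = 1 - r'/r ≤ log r - log r'. The bound is
free of `c`, hence uniform in the activity of the edge itself. -/
theorem abs_div_one_add_sub_le {c r r' : ℝ} (hc : 0 < c) (hr : 0 < r) (hr' : 0 < r') :
    |c * r / (1 + c * r) - c * r' / (1 + c * r')| ≤ |Real.log r - Real.log r'| := by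
  have h1 : 0 < c * r := mul_pos hc hr
  have h2 : 0 < c * r' := mul_pos hc hr'
  wlog h : r' ≤ r generalizing r r'
  · rw [abs_sub_comm, abs_sub_comm (Real.log r)]
    exact this hr' hr h2 h1 (le_of_not_ge h)
  have h3 : c * r' ≤ c * r := mul_le_mul_of_nonneg_left h hc.le
  have h4 : c * r / (1 + c * r) - c * r' / (1 + c * r') =
      (c * r - c * r') / ((1 + c * r) * (1 + c * r')) := by
    field_simp
    ring
  have h5 := Real.add_one_le_exp (Real.log r' - Real.log r)
  rw [Real.exp_sub, Real.exp_log hr, Real.exp_log hr'] at h5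
  have h6 : 0 ≤ c * r - c * r' := by linarith
  rw [h4, abs_of_nonneg (by positivity)]
  refine le_trans ?_ (le_abs_self _)
  have h7 : (c * r - c * r') / ((1 + c * r) * (1 + c * r')) ≤ (c * r - c * r') / (c * r) := by
    refine div_le_div_of_nonneg_left h6 h1 ?_
    nlinarith [mul_pos h1 h2]
  have h8 : (c * r - c * r') / (c * r) = 1 - r' / r := by
    field_simp
  linarith

end Contraction

/-! ### Correlation decay along self-avoiding walks -/

section Decay

open scoped Classical

variable {V : Type*} {G : SimpleGraph V}

/-- `F` and `F'` have the same edges at the vertices at distance less than `n` from `x`. -/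
def LocallyAgree (n : ℕ) (x : V) (F F' : Finset G.edgeSet) : Prop :=
  ∀ e : G.edgeSet, (∃ u ∈ (e : Sym2 V), G.edist x u < n) → (e ∈ F ↔ e ∈ F')

theorem LocallyAgree.avoidVertex {n : ℕ} {x : V} {F F' : Finset G.edgeSet}
    (h : LocallyAgree n x F F') (z : V) :
    LocallyAgree n x (avoidVertex F z) (avoidVertex F' z) := by
  intro e he
  rw [mem_avoidVertex, mem_avoidVertex, h e he]

theorem LocallyAgree.avoidEdge {n : ℕ} {x : V} {F F' : Finset G.edgeSet}
    (h : LocallyAgree n x F F') (f : G.edgeSet) :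
    LocallyAgree n x (avoidEdge F f) (avoidEdge F' f) := by
  intro e he
  rw [mem_avoidEdge, mem_avoidEdge, h e he]

theorem LocallyAgree.erase {n : ℕ} {x : V} {F F' : Finset G.edgeSet}
    (h : LocallyAgree n x F F') (f : G.edgeSet) :
    LocallyAgree n x (F.erase f) (F'.erase f) := by
  intro e he
  rw [Finset.mem_erase, Finset.mem_erase, h e he]

theorem LocallyAgree.of_adj {n : ℕ} {x y : V} {F F' : Finset G.edgeSet}
    (h : LocallyAgree (n + 1) x F F') (hxy : G.Adj x y) : LocallyAgree n y F F' := by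
  rintro e ⟨u, hu, hd⟩
  refine h e ⟨u, hu, ?_⟩
  have h1 : G.edist x u ≤ 1 + G.edist y u :=
    (SimpleGraph.edist_triangle (v := y)).trans
      (add_le_add_left (SimpleGraph.edist_eq_one_iff_adj.2 hxy).le _)
  refine h1.trans_lt ?_
  push_cast
  rw [add_comm]
  exact (ENat.add_lt_add_iff_right ENat.one_ne_top).2 hd

/-- Total activity at most `Λ` forces the monomer probability into [1 / (1 + Λ), 1] for every edge
set. This starts the contraction at a good vertex. -/
theorem abs_log_monomerProb_sub_le {a : G.edgeSet → ℝ} (ha : ∀ e, 0 < a e) {Λ : ℝ} {x : V}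
    (hx : ∀ F : Finset G.edgeSet, ∑ e ∈ F.filter (fun e : G.edgeSet => x ∈ (e : Sym2 V)), a e ≤ Λ)
    (F F' : Finset G.edgeSet) :
    |Real.log (monomerProb a F x) - Real.log (monomerProb a F' x)| ≤ Real.log (1 + Λ) := by
  have h : ∀ F : Finset G.edgeSet, -Real.log (1 + Λ) ≤ Real.log (monomerProb a F x) := by
    intro F
    have h0 : 0 ≤ ∑ e ∈ F.filter (fun e : G.edgeSet => x ∈ (e : Sym2 V)),
        a e * (matchingSum a (avoidEdge F e) / matchingSum a (avoidVertex F x)) :=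
      Finset.sum_nonneg fun e _ => mul_nonneg (ha e).le
        (div_nonneg (matchingSum_pos ha _).le (matchingSum_pos ha _).le)
    rw [monomerProb_eq ha, Real.log_inv, neg_le_neg_iff]
    refine Real.log_le_log (by linarith) ?_
    refine add_le_add_right ((Finset.sum_le_sum fun e he => ?_).trans (hx F)) 1
    obtain ⟨y, hy⟩ := (Sym2.mem_iff_exists.1 (Finset.mem_filter.1 he).2)
    rw [matchingSum_avoidEdge_div hy]
    exact mul_le_of_le_one_right (ha e).le (monomerProb_le_one ha _ _)
  have h' : ∀ F : Finset G.edgeSet, Real.log (monomerProb a F x) ≤ 0 := fun F =>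
    Real.log_nonpos (monomerProb_pos ha F x).le (monomerProb_le_one ha F x)
  rw [abs_le]
  constructor <;> linarith [h F, h F', h' F, h' F']

variable [Fintype V]

/-- The vertex sets of the self-avoiding walks of length `n` from `x` in `G`
that do not visit `A` after their start. -/
def pathSets (G : SimpleGraph V) : ℕ → Finset V → V → Finset (Finset V)
  | 0, _, x => {{x}}
  | n + 1, A, x =>
    (Finset.univ.filter fun y => G.Adj x y ∧ y ∉ insert x A).biUnion fun y =>
      (pathSets G n (insert x A) y).image (insert x)

theorem mem_pathSets_succ {n : ℕ} {A : Finset V} {x : V} {S : Finset V} :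
    S ∈ pathSets G (n + 1) A x ↔
      ∃ y, (G.Adj x y ∧ y ∉ insert x A) ∧ ∃ T ∈ pathSets G n (insert x A) y, insert x T = S := by
  simp [pathSets]

theorem disjoint_of_mem_pathSets {n : ℕ} {A : Finset V} {x : V} (hx : x ∉ A) {S : Finset V}
    (hS : S ∈ pathSets G n A x) : Disjoint S A := by
  induction n generalizing A x S with
  | zero =>
    rw [pathSets, Finset.mem_singleton] at hS
    simpa [hS] using hx
  | succ n ih =>
    obtain ⟨y, ⟨_, hy⟩, T, hT, rfl⟩ := mem_pathSets_succ.1 hS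
    have := ih hy hT
    rw [Finset.disjoint_insert_right] at this
    exact Finset.disjoint_insert_left.2 ⟨hx, this.2⟩

theorem card_of_mem_pathSets {n : ℕ} {A : Finset V} {x : V} {S : Finset V}
    (hS : S ∈ pathSets G n A x) : S.card = n + 1 := by
  induction n generalizing A x S with
  | zero =>
    rw [pathSets, Finset.mem_singleton] at hS
    simp [hS]
  | succ n ih =>
    obtain ⟨y, ⟨_, hy⟩, T, hT, rfl⟩ := mem_pathSets_succ.1 hS
    have := disjoint_of_mem_pathSets hy hT
    rw [Finset.disjoint_insert_right] at this
    rw [Finset.card_insert_of_notMem this.1, ih hT]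

theorem card_pathSets_le {D : ℕ} (hD : ∀ x, (Finset.univ.filter fun y => G.Adj x y).card ≤ D)
    (n : ℕ) (A : Finset V) (x : V) : (pathSets G n A x).card ≤ D ^ n := by
  induction n generalizing A x with
  | zero => simp [pathSets]
  | succ n ih =>
    rw [pathSets, pow_succ']
    refine (Finset.card_biUnion_le_card_mul _ _ (D ^ n) fun y _ =>
      Finset.card_image_le.trans (ih _ _)).trans (Nat.mul_le_mul_right _ (le_trans ?_ (hD x)))
    exact Finset.card_le_card fun y hy => by
      simp only [Finset.mem_filter, Finset.mem_univ, true_and] at hy ⊢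
      exact hy.1

/-- Correlation decay for monomer probabilities: each vertex with small total activity on a
self-avoiding walk contracts the logarithmic distance by the factor `Λ / (1 + Λ)`. -/
theorem abs_log_monomerProb_sub_le_pow {a : G.edgeSet → ℝ} (ha : ∀ e, 0 < a e) {Λ : ℝ}
    (hΛ : 0 ≤ Λ) {good : V → Prop}
    (hgood : ∀ x, good x → ∀ F : Finset G.edgeSet,
      ∑ e ∈ F.filter (fun e : G.edgeSet => x ∈ (e : Sym2 V)), a e ≤ Λ)
    {n k : ℕ} {A : Finset V} {x : V} {F F' : Finset G.edgeSet}
    (hFA : ∀ e ∈ F, ∀ v ∈ A, v ∉ (e : Sym2 V)) (hFF' : LocallyAgree n x F F')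
    (hk : ∀ S ∈ pathSets G n A x, k + 1 ≤ (S.filter good).card) :
    |Real.log (monomerProb a F x) - Real.log (monomerProb a F' x)| ≤
      Real.log (1 + Λ) * (Λ / (1 + Λ)) ^ k := by
  have hL : 0 ≤ Real.log (1 + Λ) := Real.log_nonneg (by linarith)
  have hθ : 0 ≤ Λ / (1 + Λ) := by positivity
  induction n generalizing A x F F' k with
  | zero =>
    have h := hk {x} (by simp [pathSets])
    rw [Finset.filter_singleton] at h
    by_cases hx : good x
    · rw [if_pos hx, Finset.card_singleton] at h
      -- A walk of length 0 has one vertex, so that vertex is good and nothing is left to contract.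
      obtain rfl : k = 0 := by omega
      simpa using abs_log_monomerProb_sub_le ha (hgood x hx) F F'
    · rw [if_neg hx, Finset.card_empty] at h
      omega
  | succ n ih =>
    have hfilter : F'.filter (fun e : G.edgeSet => x ∈ (e : Sym2 V)) =
        F.filter (fun e : G.edgeSet => x ∈ (e : Sym2 V)) := by
      ext e
      simp only [Finset.mem_filter, and_congr_left_iff]
      intro hx
      refine (hFF' e ⟨x, hx, ?_⟩).symm
      rw [SimpleGraph.edist_self]
      exact_mod_cast Nat.succ_pos n
    -- `Λ'` is left free: it will be `Λ` at a good vertex, which uses up one good vertex of the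
    -- walk, and the actual total activity at a bad one, where the factor is only known to be at
    -- most 1.
    have hstep : ∀ (j : ℕ) (Λ' : ℝ), (∀ S, ∀ T ∈ pathSets G (n + 1) A x, T = insert x S → x ∉ S →
          j + 1 ≤ (S.filter good).card) →
        ∑ e ∈ F.filter (fun e : G.edgeSet => x ∈ (e : Sym2 V)), a e ≤ Λ' →
        |Real.log (monomerProb a F x) - Real.log (monomerProb a F' x)| ≤
          Λ' / (1 + Λ') * (Real.log (1 + Λ) * (Λ / (1 + Λ)) ^ j) := by
      intro j Λ' hj hΛ'
      rw [monomerProb_eq ha F, monomerProb_eq ha F', hfilter]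
      refine abs_log_inv_one_add_sum_le (fun e => (ha e).le) ?_ ?_ hΛ' (by positivity) ?_
      · intro e he
        obtain ⟨y, hy⟩ := Sym2.mem_iff_exists.1 (Finset.mem_filter.1 he).2
        rw [matchingSum_avoidEdge_div hy]
        exact ⟨monomerProb_pos ha _ _, monomerProb_le_one ha _ _⟩
      · intro e he
        obtain ⟨y, hy⟩ := Sym2.mem_iff_exists.1 (Finset.mem_filter.1 he).2
        rw [matchingSum_avoidEdge_div hy]
        exact ⟨monomerProb_pos ha _ _, monomerProb_le_one ha _ _⟩
      · intro e he
        obtain ⟨y, hy⟩ := Sym2.mem_iff_exists.1 (Finset.mem_filter.1 he).2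
        have hxy : G.Adj x y := by
          have := e.2
          rwa [hy, SimpleGraph.mem_edgeSet] at this
        -- `F` has no edge at the visited set `A`, so the recursion only moves to unvisited
        -- vertices.
        have hyA : y ∉ insert x A := by
          rw [Finset.mem_insert, not_or]
          refine ⟨hxy.ne', fun hyA => hFA e (Finset.mem_filter.1 he).1 y hyA ?_⟩
          rw [hy]
          exact Sym2.mem_mk_right _ _
        rw [matchingSum_avoidEdge_div hy, matchingSum_avoidEdge_div hy]
        refine ih (A := insert x A) ?_ ((hFF'.of_adj hxy).avoidVertex x) ?_
        · intro f hf v hv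
          obtain ⟨hfF, hxf⟩ := mem_avoidVertex.1 hf
          rcases Finset.mem_insert.1 hv with rfl | hv
          · exact hxf
          · exact hFA f hfF v hv
        · intro S hS
          have hd := disjoint_of_mem_pathSets hyA hS
          rw [Finset.disjoint_insert_right] at hd
          exact hj S _ (mem_pathSets_succ.2 ⟨y, ⟨hxy, hyA⟩, S, hS, rfl⟩) rfl hd.1
    by_cases hx : good x
    · cases k with
      | zero => simpa using abs_log_monomerProb_sub_le ha (hgood x hx) F F'
      | succ k =>
        refine (hstep k Λ ?_ (hgood x hx F)).trans_eq (by ring)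
        rintro S T hT rfl hxS
        have := hk _ hT
        rw [Finset.filter_insert, if_pos hx, Finset.card_insert_of_notMem (by simp [hxS])] at this
        omega
    · refine (hstep k _ ?_ le_rfl).trans (mul_le_of_le_one_left (by positivity) ?_)
      · rintro S T hT rfl hxS
        have := hk _ hT
        rwa [Finset.filter_insert, if_neg hx] at this
      · have : 0 ≤ ∑ e ∈ F.filter (fun e : G.edgeSet => x ∈ (e : Sym2 V)), a e :=
          Finset.sum_nonneg fun e _ => (ha e).le
        exact div_le_one_of_le₀ (by linarith) (by linarith)

end Decay

end

end MonomerDimer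

namespace MonomerDimer

noncomputable section

/-! ### Locality of edge and vertex probabilities -/

section Locality

open scoped Classical

variable {V : Type*} {G : SimpleGraph V} {a : G.edgeSet → ℝ} {n : ℕ} {b : ℝ}
  {F F' : Finset G.edgeSet}

/-- The monomer probability at `x` depends up to `b`, in logarithmic scale, only on the edges at
distance less than `n` from `x`. -/
def MonomerDecay (a : G.edgeSet → ℝ) (n : ℕ) (b : ℝ) (x : V) : Prop :=
  ∀ F F' : Finset G.edgeSet, LocallyAgree n x F F' →
    |Real.log (monomerProb a F x) - Real.log (monomerProb a F' x)| ≤ b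

theorem abs_monomerProb_sub_le (ha : ∀ e, 0 < a e) {x : V} (hx : MonomerDecay a n b x)
    (h : LocallyAgree n x F F') : |monomerProb a F x - monomerProb a F' x| ≤ b :=
  (abs_sub_le_abs_log_sub (monomerProb_pos ha _ _) (monomerProb_le_one ha _ _)
    (monomerProb_pos ha _ _) (monomerProb_le_one ha _ _)).trans (hx F F' h)

/-- The error is `b` for each endpoint, because log r in `matchingProb_mem_eq` is a sum of two
logarithms of monomer probabilities. -/
theorem abs_matchingProb_mem_sub_le (ha : ∀ e, 0 < a e) {e : G.edgeSet}
    (hdec : ∀ x ∈ (e : Sym2 V), MonomerDecay a n b x)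
    (h : ∀ x ∈ (e : Sym2 V), LocallyAgree n x F F') (heF : e ∈ F) (heF' : e ∈ F') :
    |matchingProb a F {M | e ∈ M} - matchingProb a F' {M | e ∈ M}| ≤ 2 * b := by
  obtain ⟨x, y, hxy⟩ : ∃ x y, (e : Sym2 V) = s(x, y) :=
    ⟨_, _, (Quot.out_eq (e : Sym2 V)).symm⟩
  have hx : x ∈ (e : Sym2 V) := hxy ▸ Sym2.mem_mk_left x y
  have hy : y ∈ (e : Sym2 V) := hxy ▸ Sym2.mem_mk_right x y
  have hp : ∀ F x, 0 < monomerProb a F x := monomerProb_pos ha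
  rw [matchingProb_mem_eq ha heF hxy, matchingProb_mem_eq ha heF' hxy]
  refine (abs_div_one_add_sub_le (ha e) (mul_pos (hp _ _) (hp _ _))
    (mul_pos (hp _ _) (hp _ _))).trans ?_
  rw [Real.log_mul (hp _ _).ne' (hp _ _).ne', Real.log_mul (hp _ _).ne' (hp _ _).ne',
    add_sub_add_comm, two_mul]
  exact (abs_add_le _ _).trans (add_le_add (hdec x hx _ _ ((h x hx).erase e))
    (hdec y hy _ _ (((h y hy).erase e).avoidVertex x)))

theorem abs_mul_sub_mul_le {p q p' q' s t : ℝ} (hq : |q| ≤ 1) (hp' : |p'| ≤ 1)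
    (h : |p - p'| ≤ s) (h' : |q - q'| ≤ t) : |p * q - p' * q'| ≤ s + t := by
  have : p * q - p' * q' = (p - p') * q + p' * (q - q') := by ring
  rw [this]
  refine (abs_add_le _ _).trans (add_le_add ?_ ?_)
  · rw [abs_mul]
    exact (mul_le_of_le_one_right (abs_nonneg _) hq).trans h
  · rw [abs_mul]
    exact (mul_le_of_le_one_left (abs_nonneg _) hp').trans h'

theorem abs_matchingProb_le_one (ha : ∀ e, 0 < a e) (F : Finset G.edgeSet)
    (S : Set (Finset G.edgeSet)) : |matchingProb a F S| ≤ 1 := by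
  rw [abs_of_nonneg (matchingProb_nonneg ha F S)]
  exact matchingProb_le_one ha F S

theorem abs_matchingProb_sub_le_one (ha : ∀ e, 0 < a e) (F F' : Finset G.edgeSet)
    (S : Set (Finset G.edgeSet)) : |matchingProb a F S - matchingProb a F' S| ≤ 1 := by
  rw [abs_le]
  constructor <;> linarith [matchingProb_nonneg ha F S, matchingProb_le_one ha F S,
    matchingProb_nonneg ha F' S, matchingProb_le_one ha F' S]

theorem abs_matchingProb_cov_le_one (ha : ∀ e, 0 < a e) (F : Finset G.edgeSet)
    (S T : Set (Finset G.edgeSet)) :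
    |matchingProb a F (S ∩ T) - matchingProb a F S * matchingProb a F T| ≤ 1 := by
  have h0 := matchingProb_nonneg ha F
  have h1 := matchingProb_le_one ha F
  have h2 := mul_nonneg (h0 S) (h0 T)
  have h3 := mul_le_one₀ (h1 S) (h0 T) (h1 T)
  rw [abs_le]
  constructor <;> linarith [h0 (S ∩ T), h1 (S ∩ T)]

theorem abs_matchingProb_unmatched_cov_le (ha : ∀ e, 0 < a e) {x y : V}
    (hy : MonomerDecay a n b y) (h : LocallyAgree n y (avoidVertex F x) F) :
    |matchingProb a F ({M | Unmatched x M} ∩ {M | Unmatched y M}) -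
      matchingProb a F {M | Unmatched x M} * matchingProb a F {M | Unmatched y M}| ≤ b := by
  rw [matchingProb_unmatched_inter ha, matchingProb_unmatched, matchingProb_unmatched, ← mul_sub,
    abs_mul, abs_of_pos (monomerProb_pos ha F x)]
  exact (mul_le_of_le_one_left (abs_nonneg _) (monomerProb_le_one ha F x)).trans
    (abs_monomerProb_sub_le ha hy h)

theorem abs_matchingProb_unmatched_inter_sub_le (ha : ∀ e, 0 < a e) {x y : V}
    (hx : MonomerDecay a n b x) (hy : MonomerDecay a n b y)
    (h : LocallyAgree n x F F') (h' : LocallyAgree n y F F') :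
    |matchingProb a F ({M | Unmatched x M} ∩ {M | Unmatched y M}) -
      matchingProb a F' ({M | Unmatched x M} ∩ {M | Unmatched y M})| ≤ b + b := by
  rw [matchingProb_unmatched_inter ha, matchingProb_unmatched_inter ha]
  refine abs_mul_sub_mul_le ?_ ?_ (abs_monomerProb_sub_le ha hx h)
    (abs_monomerProb_sub_le ha hy (h'.avoidVertex x))
  all_goals
    rw [abs_of_pos (monomerProb_pos ha _ _)]
    exact monomerProb_le_one ha _ _

theorem abs_matchingProb_mem_cov_le (ha : ∀ e, 0 < a e) {e f : G.edgeSet} (he : e ∈ F)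
    (hf : f ∈ avoidEdge F e) (hdec : ∀ x ∈ (f : Sym2 V), MonomerDecay a n b x)
    (h : ∀ x ∈ (f : Sym2 V), LocallyAgree n x (avoidEdge F e) F) :
    |matchingProb a F ({M | e ∈ M} ∩ {M | f ∈ M}) -
      matchingProb a F {M | e ∈ M} * matchingProb a F {M | f ∈ M}| ≤ 2 * b := by
  rw [matchingProb_mem_inter ha he hf, ← mul_sub, abs_mul]
  exact (mul_le_of_le_one_left (abs_nonneg _) (abs_matchingProb_le_one ha _ _)).trans
    (abs_matchingProb_mem_sub_le ha hdec h hf (mem_avoidEdge.1 hf).1)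

/-- Disjoint edges are treated by conditioning on `e`. Equal edges reduce to one edge, and distinct
edges with a common endpoint never occur together. -/
theorem abs_matchingProb_mem_inter_sub_le (ha : ∀ e, 0 < a e) {e f : G.edgeSet}
    (he : e ∈ F) (he' : e ∈ F') (hf : f ∈ F) (hf' : f ∈ F')
    (hdec : ∀ x, x ∈ (e : Sym2 V) ∨ x ∈ (f : Sym2 V) → MonomerDecay a n b x)
    (h : ∀ x, x ∈ (e : Sym2 V) ∨ x ∈ (f : Sym2 V) → LocallyAgree n x F F') :
    |matchingProb a F ({M | e ∈ M} ∩ {M | f ∈ M}) -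
      matchingProb a F' ({M | e ∈ M} ∩ {M | f ∈ M})| ≤ 2 * b + 2 * b := by
  have h1 := abs_matchingProb_mem_sub_le ha (fun x hx => hdec x (Or.inl hx))
    (fun x hx => h x (Or.inl hx)) he he'
  have hb : 0 ≤ 2 * b := (abs_nonneg _).trans h1
  by_cases hef : e = f
  · subst hef
    rw [Set.inter_self]
    linarith
  by_cases hd : ∀ x : V, x ∈ (e : Sym2 V) → x ∉ (f : Sym2 V)
  · have hfe : f ∈ avoidEdge F e := mem_avoidEdge.2 ⟨hf, hd⟩
    have hfe' : f ∈ avoidEdge F' e := mem_avoidEdge.2 ⟨hf', hd⟩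
    rw [matchingProb_mem_inter ha he hfe, matchingProb_mem_inter ha he' hfe']
    exact abs_mul_sub_mul_le (abs_matchingProb_le_one ha _ _) (abs_matchingProb_le_one ha _ _) h1
      (abs_matchingProb_mem_sub_le ha (fun x hx => hdec x (Or.inr hx))
        (fun x hx => (h x (Or.inr hx)).avoidEdge e) hfe hfe')
  · push Not at hd
    obtain ⟨x, hxe, hxf⟩ := hd
    rw [matchingProb_mem_inter_eq_zero hef hxe hxf, matchingProb_mem_inter_eq_zero hef hxe hxf,
      sub_self, abs_zero]
    linarith

/-- By inclusion-exclusion all four cells are combinations of the probabilities of `S`, `T`, `S ∩ T`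
with coefficients 0 or ±1, up to a constant. -/
theorem abs_matchingProb_event_sub_le (ha : ∀ e, 0 < a e) (S T : Set (Finset G.edgeSet))
    (δ₁ δ₂ : Bool) {s t u : ℝ} (hS : |matchingProb a F S - matchingProb a F' S| ≤ s)
    (hT : |matchingProb a F T - matchingProb a F' T| ≤ t)
    (hST : |matchingProb a F (S ∩ T) - matchingProb a F' (S ∩ T)| ≤ u) :
    |matchingProb a F {M | (M ∈ S ↔ δ₁ = true) ∧ (M ∈ T ↔ δ₂ = true)} -
      matchingProb a F' {M | (M ∈ S ↔ δ₁ = true) ∧ (M ∈ T ↔ δ₂ = true)}| ≤ s + t + u := by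
  rw [abs_le] at hS hT hST
  have key : ∀ F : Finset G.edgeSet,
      matchingProb a F (S \ T) = matchingProb a F S - matchingProb a F (S ∩ T) ∧
      matchingProb a F (T \ S) = matchingProb a F T - matchingProb a F (S ∩ T) ∧
      matchingProb a F (Sᶜ \ T) =
        1 - matchingProb a F S - matchingProb a F T + matchingProb a F (S ∩ T) := by
    intro F
    have h1 := matchingProb_inter_add_diff (a := a) F S T
    have h2 := matchingProb_inter_add_diff (a := a) F T S
    have h3 := matchingProb_inter_add_diff (a := a) F Sᶜ T
    have h4 := matchingProb_inter_add_diff (a := a) F Set.univ S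
    rw [matchingProb_univ ha, Set.univ_inter, ← Set.compl_eq_univ_sdiff] at h4
    rw [Set.inter_comm] at h2
    have h5 : Sᶜ ∩ T = T \ S := by
      ext M
      simp [and_comm]
    rw [h5] at h3
    refine ⟨?_, ?_, ?_⟩ <;> linarith
  obtain ⟨k1, k2, k3⟩ := key F
  obtain ⟨k1', k2', k3'⟩ := key F'
  have e11 : {M | (M ∈ S ↔ true = true) ∧ (M ∈ T ↔ true = true)} = S ∩ T := by
    ext M
    simp
  have e10 : {M | (M ∈ S ↔ true = true) ∧ (M ∈ T ↔ false = true)} = S \ T := by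
    ext M
    simp
  have e01 : {M | (M ∈ S ↔ false = true) ∧ (M ∈ T ↔ true = true)} = T \ S := by
    ext M
    simp [and_comm]
  have e00 : {M | (M ∈ S ↔ false = true) ∧ (M ∈ T ↔ false = true)} = Sᶜ \ T := by
    ext M
    simp
  cases δ₁ <;> cases δ₂
  · rw [e00, k3, k3', abs_le]
    constructor <;> linarith
  · rw [e01, k2, k2', abs_le]
    constructor <;> linarith
  · rw [e10, k1, k1', abs_le]
    constructor <;> linarith
  · rw [e11, abs_le]
    constructor <;> linarith

end Locality

/-! ### Reduction of the Gibbs measure to edge activities -/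

section Gibbs

open scoped Classical

variable {V : Type*} [Fintype V] {G : SimpleGraph V}

/-- The activity of an edge after the vertex weights have been absorbed in the edge weights. -/
def edgeActivity (w : G.edgeSet → ℝ) (ν : V → ℝ) (e : G.edgeSet) : ℝ :=
  Real.exp (w e - ∑ x with x ∈ (e : Sym2 V), ν x)

theorem edgeActivity_pos (w : G.edgeSet → ℝ) (ν : V → ℝ) (e : G.edgeSet) :
    0 < edgeActivity w ν e :=
  Real.exp_pos _

theorem edgeActivity_eq (w : G.edgeSet → ℝ) (ν : V → ℝ) {e : G.edgeSet} {x y : V}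
    (h : (e : Sym2 V) = s(x, y)) : edgeActivity w ν e = Real.exp (w e - ν x - ν y) := by
  have hxy : x ≠ y := by
    have := e.2
    rw [h, SimpleGraph.mem_edgeSet] at this
    exact this.ne
  have : (Finset.univ.filter fun z : V => z ∈ (e : Sym2 V)) = {x, y} := by
    ext z
    simp [h]
  rw [edgeActivity, this, Finset.sum_pair hxy, sub_sub]

/-- The edges of the subgraph `H`. -/
def edgesOf (H : G.Subgraph) : Finset G.edgeSet :=
  Finset.univ.filter fun e => (e : Sym2 V) ∈ H.edgeSet

theorem mem_edgesOf {H : G.Subgraph} {e : G.edgeSet} :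
    e ∈ edgesOf H ↔ (e : Sym2 V) ∈ H.edgeSet := by
  simp [edgesOf]

theorem matchings_eq (H : G.Subgraph) : matchings H = matchingsIn (edgesOf H) := by
  ext M
  simp only [mem_matchings, IsMatching, mem_matchingsIn, Finset.subset_iff, mem_edgesOf]

/-- The matched vertices are the disjoint union of the endpoint pairs of `M` and lie in `H`.
Subtracting their weights from the total charges each edge for its endpoints and leaves a prefactor
independent of `M`. -/
theorem boltzmann_eq {H : G.Subgraph} (w : G.edgeSet → ℝ) (ν : V → ℝ) {M : Finset G.edgeSet}
    (hM : M ∈ matchings H) :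
    boltzmann H w ν M =
      Real.exp (∑ x with x ∈ H.verts, ν x) * ∏ e ∈ M, edgeActivity w ν e := by
  obtain ⟨h1, h2⟩ := (mem_matchings H M).1 hM
  have h3 : (Finset.univ.filter fun x => x ∈ H.verts ∧ ¬ Unmatched x M) =
      M.biUnion fun e => Finset.univ.filter fun x => x ∈ (e : Sym2 V) := by
    ext x
    simp only [Finset.mem_filter, Finset.mem_univ, true_and, Finset.mem_biUnion, Unmatched,
      not_forall, not_not]
    constructor
    · rintro ⟨_, e, he, hx⟩
      exact ⟨e, he, hx⟩
    · rintro ⟨e, he, hx⟩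
      exact ⟨H.mem_verts_of_mem_edge (h1 e he) hx, e, he, hx⟩
  have h4 : ∑ x with x ∈ H.verts ∧ ¬ Unmatched x M, ν x =
      ∑ e ∈ M, ∑ x with x ∈ (e : Sym2 V), ν x := by
    rw [h3, Finset.sum_biUnion]
    intro e he f hf hne
    rw [Function.onFun, Finset.disjoint_left]
    intro x hx hx'
    exact h2 e he f hf hne x (Finset.mem_filter.1 hx).2 (Finset.mem_filter.1 hx').2
  have h5 : ∑ x with x ∈ H.verts, ν x =
      ∑ x with x ∈ H.verts ∧ Unmatched x M, ν x +
        ∑ x with x ∈ H.verts ∧ ¬ Unmatched x M, ν x := by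
    rw [← Finset.sum_filter_add_sum_filter_not _ (fun x => Unmatched x M), Finset.filter_filter,
      Finset.filter_filter]
  have h6 : boltzmann H w ν M =
      Real.exp (∑ e ∈ M, w e + ∑ x with x ∈ H.verts ∧ Unmatched x M, ν x) := by
    unfold boltzmann
    congr!
  rw [h6]
  simp only [edgeActivity]
  rw [← Real.exp_sum, ← Real.exp_add, h5, h4, Finset.sum_sub_distrib]
  congr 1
  ring

theorem gibbsProb_eq (H : G.Subgraph) (w : G.edgeSet → ℝ) (ν : V → ℝ)
    (S : Set (Finset G.edgeSet)) :
    gibbsProb H w ν S = matchingProb (edgeActivity w ν) (edgesOf H) S := by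
  set c := Real.exp (∑ x with x ∈ H.verts, ν x) with hc
  have hc0 : c ≠ 0 := (Real.exp_pos _).ne'
  have hZ : partitionFunction H w ν = c * matchingSum (edgeActivity w ν) (edgesOf H) := by
    rw [partitionFunction, matchingSum, ← matchings_eq, Finset.mul_sum]
    exact Finset.sum_congr rfl fun M hM => boltzmann_eq w ν hM
  rw [gibbsProb, gibbsExp, matchingProb, hZ, ← matchings_eq, Finset.sum_div]
  refine Finset.sum_congr rfl fun M hM => ?_
  rw [boltzmann_eq w ν hM, ← hc, mul_div_mul_left _ _ hc0]
  by_cases h : M ∈ S <;> simp [h]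

end Gibbs

end

end MonomerDimer

namespace MonomerDimer

noncomputable section

/-! ### Good vertices and the probability that a walk sees too few of them -/

theorem exists_forall_measure_abs_gt_le (ρ : Measure ℝ) [IsProbabilityMeasure ρ] {ε : ℝ≥0∞}
    (hε : 0 < ε) : ∃ K₀ : ℝ, ∀ K, K₀ ≤ K → ρ {r | K < |r|} ≤ ε := by
  have h : Filter.Tendsto (fun n : ℕ => ρ {r : ℝ | (n : ℝ) < |r|}) Filter.atTop (nhds 0) := by
    have h1 := tendsto_measure_iInter_atTop (μ := ρ) (s := fun n : ℕ => {r : ℝ | (n : ℝ) < |r|})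
      (fun n => (measurableSet_lt measurable_const measurable_norm).nullMeasurableSet)
      (fun n m hnm r (hr : (m : ℝ) < |r|) => (Nat.cast_le.2 hnm).trans_lt hr)
      ⟨0, measure_ne_top _ _⟩
    have h2 : (⋂ n : ℕ, {r : ℝ | (n : ℝ) < |r|}) = ∅ := by
      refine Set.eq_empty_of_forall_notMem fun r hr => ?_
      obtain ⟨n, hn⟩ := exists_nat_ge |r|
      exact not_lt.2 hn (Set.mem_iInter.1 hr n)
    rwa [h2, measure_empty] at h1
  obtain ⟨n, hn⟩ := (h.eventually (ge_mem_nhds hε)).exists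
  exact ⟨n, fun K hK => (measure_mono fun r (hr : K < |r|) => hK.trans_lt hr).trans hn⟩

section Star

open scoped Classical

variable {V : Type*} [Fintype V] {G : SimpleGraph V}

/-- The weights on which the edge activities at the vertex `v` depend. -/
def starOf (G : SimpleGraph V) (v : V) : Finset (G.edgeSet ⊕ V) :=
  (Finset.univ.filter fun e : G.edgeSet => v ∈ (e : Sym2 V)).disjSum
    (insert v (Finset.univ.filter fun y => G.Adj v y))

/-- The weights near the vertex `y` are bounded by `K` in absolute value. -/
def TameAt (v : G.edgeSet ⊕ V → ℝ) (K : ℝ) (y : V) : Prop :=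
  ∀ i ∈ starOf G y, |v i| ≤ K

theorem card_edges_at_le {D : ℕ} (hD : ∀ x, (Finset.univ.filter fun y => G.Adj x y).card ≤ D)
    (v : V) : (Finset.univ.filter fun e : G.edgeSet => v ∈ (e : Sym2 V)).card ≤ D := by
  refine le_trans ?_ (hD v)
  rw [← Finset.card_image_of_injective _ (Subtype.val_injective)]
  refine le_trans (Finset.card_le_card ?_)
    (Finset.card_image_le (s := Finset.univ.filter fun y => G.Adj v y) (f := fun y => s(v, y)))
  intro z hz
  obtain ⟨e, he, rfl⟩ := Finset.mem_image.1 hz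
  obtain ⟨y, hy⟩ := Sym2.mem_iff_exists.1 (Finset.mem_filter.1 he).2
  refine Finset.mem_image.2 ⟨y, ?_, hy.symm⟩
  have := e.2
  rw [hy, SimpleGraph.mem_edgeSet] at this
  simpa using this

theorem card_starOf_le {D : ℕ} (hD : ∀ x, (Finset.univ.filter fun y => G.Adj x y).card ≤ D)
    (v : V) : (starOf G v).card ≤ 2 * D + 1 := by
  rw [starOf, Finset.card_disjSum]
  have h1 := card_edges_at_le hD v
  have h2 := Finset.card_insert_le v (Finset.univ.filter fun y => G.Adj v y)
  have h3 := hD v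
  omega

/-- An edge weight is near its 2 endpoints, a vertex weight near at most D + 1 vertices; D + 2
covers both. -/
theorem card_mem_starOf_le {D : ℕ} (hD : ∀ x, (Finset.univ.filter fun y => G.Adj x y).card ≤ D)
    (i : G.edgeSet ⊕ V) : (Finset.univ.filter fun v => i ∈ starOf G v).card ≤ D + 2 := by
  rcases i with e | y
  · obtain ⟨x, y, hxy⟩ : ∃ x y, (e : Sym2 V) = s(x, y) :=
      ⟨_, _, (Quot.out_eq (e : Sym2 V)).symm⟩
    have h : (Finset.univ.filter fun v => Sum.inl e ∈ starOf G v) ⊆ {x, y} := by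
      intro v hv
      simpa [starOf, hxy] using hv
    exact (Finset.card_le_card h).trans (Finset.card_le_two.trans (by omega))
  · have h : (Finset.univ.filter fun v => Sum.inr y ∈ starOf G v) ⊆
        insert y (Finset.univ.filter fun v => G.Adj y v) := by
      intro v hv
      simp only [starOf, Finset.mem_filter, Finset.mem_univ, true_and, Finset.inr_mem_disjSum,
        Finset.mem_insert] at hv ⊢
      exact hv.imp Eq.symm SimpleGraph.Adj.symm
    refine (Finset.card_le_card h).trans ((Finset.card_insert_le _ _).trans ?_)
    have := hD y
    omega

/-- The total activity at a vertex is bounded if the weights near it are. -/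
theorem sum_edgeActivity_le {D : ℕ}
    (hD : ∀ x, (Finset.univ.filter fun y => G.Adj x y).card ≤ D) {w : G.edgeSet → ℝ} {ν : V → ℝ}
    {K : ℝ} {v : V} (hv : TameAt (Sum.elim w ν) K v) (F : Finset G.edgeSet) :
    ∑ e ∈ F.filter (fun e : G.edgeSet => v ∈ (e : Sym2 V)), edgeActivity w ν e ≤
      D * Real.exp (3 * K) := by
  have h : ∀ e ∈ F.filter (fun e : G.edgeSet => v ∈ (e : Sym2 V)),
      edgeActivity w ν e ≤ Real.exp (3 * K) := by
    intro e he
    have hve := (Finset.mem_filter.1 he).2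
    obtain ⟨y, hy⟩ := Sym2.mem_iff_exists.1 hve
    have hadj : G.Adj v y := by
      have := e.2
      rwa [hy, SimpleGraph.mem_edgeSet] at this
    have h1 := hv (Sum.inl e) (by simp [starOf, hve])
    have h2 := hv (Sum.inr v) (by simp [starOf])
    have h3 := hv (Sum.inr y) (by simp [starOf, hadj])
    simp only [Sum.elim_inl, Sum.elim_inr, abs_le] at h1 h2 h3
    rw [edgeActivity_eq w ν hy, Real.exp_le_exp]
    linarith
  refine (Finset.sum_le_card_nsmul _ _ _ h).trans ?_
  rw [nsmul_eq_mul]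
  refine mul_le_mul_of_nonneg_right ?_ (Real.exp_pos _).le
  exact_mod_cast (Finset.card_le_card (Finset.filter_subset_filter _ (Finset.subset_univ F))).trans
    (card_edges_at_le hD v)

variable {Ω : Type*}

/-- Some self-avoiding walk of length `n` from `x` sees at least `t` weights outside `I`
of absolute value larger than `K`. -/
def failEvent (u : G.edgeSet ⊕ V → Ω → ℝ) (K : ℝ) (I : Finset (G.edgeSet ⊕ V)) (n t : ℕ)
    (x : V) : Set Ω :=
  ⋃ S ∈ pathSets G n ∅ x, ⋃ T ∈ ((S.biUnion (starOf G)) \ I).powersetCard t,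
    ⋂ i ∈ T, u i ⁻¹' {r | K < |r|}

/-- Union bound: at most D^n walks, each with n + 1 stars of at most 2D + 1 weights. Independence
gives `ε ^ t` for a fixed set of `t` weights. -/
theorem measure_failEvent_le [MeasurableSpace Ω] {P : Measure Ω} {D : ℕ}
    (hD : ∀ x, (Finset.univ.filter fun y => G.Adj x y).card ≤ D)
    {u : G.edgeSet ⊕ V → Ω → ℝ} (hu : iIndepFun u P) {K : ℝ} {ε : ℝ≥0∞}
    (hε : ∀ i, P (u i ⁻¹' {r | K < |r|}) ≤ ε) (I : Finset (G.edgeSet ⊕ V)) (n t : ℕ) (x : V) :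
    P (failEvent u K I n t x) ≤ (D ^ n * 2 ^ ((n + 1) * (2 * D + 1)) : ℕ) * ε ^ t := by
  have h1 : ∀ T : Finset (G.edgeSet ⊕ V), T.card = t →
      P (⋂ i ∈ T, u i ⁻¹' {r | K < |r|}) ≤ ε ^ t := by
    intro T hT
    rw [hu.measure_inter_preimage_eq_mul T (sets := fun _ => {r | K < |r|}) fun i _ =>
      measurableSet_lt measurable_const measurable_norm, ← hT]
    exact Finset.prod_le_pow_card _ _ _ fun i _ => hε i
  have h2 : ∀ S ∈ pathSets G n ∅ x,
      P (⋃ T ∈ ((S.biUnion (starOf G)) \ I).powersetCard t, ⋂ i ∈ T, u i ⁻¹' {r | K < |r|}) ≤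
        (2 ^ ((n + 1) * (2 * D + 1)) : ℕ) * ε ^ t := by
    intro S hS
    refine (measure_biUnion_finset_le _ _).trans ((Finset.sum_le_card_nsmul _ _ (ε ^ t)
      fun T hT => h1 T (Finset.mem_powersetCard.1 hT).2).trans ?_)
    rw [nsmul_eq_mul]
    gcongr
    rw [Finset.card_powersetCard]
    refine (Nat.choose_le_two_pow _ _).trans (Nat.pow_le_pow_right two_pos ?_)
    refine (Finset.card_le_card Finset.sdiff_subset).trans ?_
    rw [← card_of_mem_pathSets hS]
    exact Finset.card_biUnion_le_card_mul _ _ _ fun v _ => card_starOf_le hD v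
  refine (measure_biUnion_finset_le _ _).trans
    ((Finset.sum_le_card_nsmul _ _ _ h2).trans ?_)
  rw [nsmul_eq_mul, ← mul_assoc, Nat.cast_mul]
  gcongr
  exact card_pathSets_le hD n ∅ x

/-- At most `m` weights on the walk are suspect: fewer than `m - 2` large ones and the at most two
in `I`, whose values in `v` are arbitrary. They spoil at most (D + 2)m of the 2(D + 2)m + 1
vertices. -/
theorem lt_card_filter_good {D : ℕ}
    (hD : ∀ x, (Finset.univ.filter fun y => G.Adj x y).card ≤ D) {u : G.edgeSet ⊕ V → Ω → ℝ}
    {K : ℝ} {I : Finset (G.edgeSet ⊕ V)} (hI : I.card ≤ 2) {m : ℕ} {x : V} {ω : Ω}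
    (hω : ω ∉ failEvent u K I (2 * (D + 2) * m) (m - 2) x) {v : G.edgeSet ⊕ V → ℝ}
    (hv : ∀ i, i ∉ I → v i = u i ω) {S : Finset V}
    (hS : S ∈ pathSets G (2 * (D + 2) * m) ∅ x) :
    m + 1 ≤ (S.filter (TameAt v K)).card := by
  set B := ((S.biUnion (starOf G)) \ I).filter fun i => K < |u i ω| with hB
  -- For m ≤ 2 the truncated difference is 0: the empty set of weights then puts every outcome in
  -- `failEvent`, contradicting `hω`.
  have hBcard : B.card < m - 2 := by
    by_contra! hle
    obtain ⟨T, hTB, hT⟩ := Finset.exists_subset_card_eq hle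
    refine hω (Set.mem_biUnion hS (Set.mem_biUnion (x := T) ?_ ?_))
    · exact Finset.mem_coe.2 (Finset.mem_powersetCard.2
        ⟨hTB.trans (Finset.filter_subset _ _), hT⟩)
    · exact Set.mem_iInter₂.2 fun i hi => (Finset.mem_filter.1 (hTB hi)).2
  have hbad : (S.filter fun y => ¬ TameAt v K y).card * 1 ≤
      (B ∪ I).card * (D + 2) := by
    refine Finset.card_mul_le_card_mul (fun y i => i ∈ starOf G y) ?_ ?_
    · intro y hy
      obtain ⟨hyS, hy⟩ := Finset.mem_filter.1 hy
      simp only [TameAt, not_forall, not_le] at hy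
      obtain ⟨i, hi, hK⟩ := hy
      refine Finset.card_pos.2 ⟨i, Finset.mem_filter.2 ⟨?_, hi⟩⟩
      rw [Finset.mem_union]
      by_cases hiI : i ∈ I
      · exact Or.inr hiI
      · rw [hv i hiI] at hK
        exact Or.inl (Finset.mem_filter.2 ⟨Finset.mem_sdiff.2
          ⟨Finset.mem_biUnion.2 ⟨y, hyS, hi⟩, hiI⟩, hK⟩)
    · intro i _
      exact (Finset.card_le_card (Finset.filter_subset_filter _ (Finset.subset_univ _))).trans
        (card_mem_starOf_le hD i)
  have hsum := Finset.card_filter_add_card_filter_not (s := S)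
    (TameAt v K)
  rw [card_of_mem_pathSets hS] at hsum
  have hun : (B ∪ I).card ≤ m := (Finset.card_union_le B I).trans (by omega)
  have h1 := Nat.mul_le_mul_right (D + 2) hun
  have h2 : m ≤ (D + 2) * m := Nat.le_mul_of_pos_left m (by omega)
  have h3 : 2 * (D + 2) * m = m * (D + 2) + (D + 2) * m := by ring
  omega

theorem monomerDecay_of_notMem_failEvent {D : ℕ}
    (hD : ∀ x, (Finset.univ.filter fun y => G.Adj x y).card ≤ D) {u : G.edgeSet ⊕ V → Ω → ℝ}
    {K : ℝ} {I : Finset (G.edgeSet ⊕ V)} (hI : I.card ≤ 2) {m : ℕ} {x : V} {ω : Ω}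
    (hω : ω ∉ failEvent u K I (2 * (D + 2) * m) (m - 2) x) {w : G.edgeSet → ℝ} {ν : V → ℝ}
    (h : ∀ i, i ∉ I → Sum.elim w ν i = u i ω) :
    MonomerDecay (edgeActivity w ν) (2 * (D + 2) * m)
      (Real.log (1 + D * Real.exp (3 * K)) *
        (D * Real.exp (3 * K) / (1 + D * Real.exp (3 * K))) ^ m) x := by
  have hgood : ∀ y, TameAt (Sum.elim w ν) K y → ∀ F : Finset G.edgeSet,
      ∑ e ∈ F.filter (fun e : G.edgeSet => y ∈ (e : Sym2 V)), edgeActivity w ν e ≤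
        D * Real.exp (3 * K) := fun y hy => sum_edgeActivity_le hD hy
  have hk : ∀ S ∈ pathSets G (2 * (D + 2) * m) ∅ x,
      m + 1 ≤ (S.filter (TameAt (Sum.elim w ν) K)).card :=
    fun S hS => lt_card_filter_good hD hI hω h hS
  generalize 2 * (D + 2) * m = n at hk ⊢
  intro F F' hFF'
  exact abs_log_monomerProb_sub_le_pow (edgeActivity_pos w ν) (by positivity) hgood (A := ∅)
    (by simp) hFF' hk

end Star

end

end MonomerDimer

namespace MonomerDimer

/-! ### Exponentially small expectations -/

noncomputable section

/-- The two exempted weights cost a factor ε^(-2), and the last vertex of the walk a factor 2^r. -/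
theorem pow_mul_two_pow_mul_pow_le (D q r m : ℕ) {ε : ℝ} (hε : 0 < ε) (hε1 : ε ≤ 1)
    (hA : (D ^ q * 2 ^ (q * r) : ℝ) * ε ≤ 1 / 2) :
    (D ^ (q * m) * 2 ^ ((q * m + 1) * r) : ℝ) * ε ^ (m - 2) ≤
      2 ^ r / ε ^ 2 * (1 / 2) ^ m := by
  have h1 : ε ^ (m - 2) ≤ ε ^ m / ε ^ 2 := by
    rw [le_div_iff₀ (by positivity), ← pow_add]
    exact pow_le_pow_of_le_one hε.le hε1 (by omega)
  have h2 := pow_le_pow_left₀ (by positivity) hA m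
  calc (D ^ (q * m) * 2 ^ ((q * m + 1) * r) : ℝ) * ε ^ (m - 2)
      ≤ (D ^ (q * m) * 2 ^ ((q * m + 1) * r) : ℝ) * (ε ^ m / ε ^ 2) := by gcongr
    _ = 2 ^ r / ε ^ 2 * ((D ^ q * 2 ^ (q * r) : ℝ) * ε) ^ m := by
      have h3 : (q * m + 1) * r = q * r * m + r := by ring
      rw [h3, pow_add, pow_mul, pow_mul _ (q * r), mul_pow, mul_pow]
      ring
    _ ≤ _ := by gcongr

/-- Since ⌊(R - 1)/q⌋ + 1 ≥ R/q, rounding costs one factor η⁻¹. -/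
theorem pow_div_le_exp {η : ℝ} (hη : 0 < η) (hη1 : η < 1) {q : ℕ} (hq : 0 < q) (R : ℕ) :
    η ^ ((R - 1) / q) ≤ η⁻¹ * Real.exp (-(-Real.log η / q) * R) := by
  have hq' : (0 : ℝ) < q := by exact_mod_cast hq
  have hlog : Real.log η < 0 := Real.log_neg hη hη1
  have h1 : R ≤ q * ((R - 1) / q + 1) := by
    have := Nat.lt_mul_div_succ (R - 1) hq
    omega
  have h2 : (R : ℝ) ≤ q * (((R - 1) / q : ℕ) + 1) := by exact_mod_cast h1
  have h3 : η ^ ((R - 1) / q + 1) ≤ Real.exp (-(-Real.log η / q) * R) := by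
    rw [← Real.exp_log hη, ← Real.exp_nat_mul, Real.exp_le_exp, Real.log_exp]
    have h4 : -(-Real.log η / q) * R = Real.log η * (R / q) := by ring
    rw [h4, mul_comm]
    refine mul_le_mul_of_nonpos_left ?_ hlog.le
    rw [div_le_iff₀ hq']
    push_cast
    linarith
  rw [← div_eq_inv_mul, le_div_iff₀ hη, ← pow_succ]
  exact h3

section Expectation

open scoped Classical

/-- A random variable bounded by `1` that is small when the monomer probabilities near a few
vertices are insensitive to far edges, uniformly in two of the weights, has an exponentially small
expectation. -/
theorem exists_expectationLE_exp (D : ℕ) (ρE ρV : Measure ℝ) [IsProbabilityMeasure ρE]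
    [IsProbabilityMeasure ρV] :
    ∃ c C : ℝ, 0 < c ∧ 0 < C ∧
      ∀ (V : Type*) [Fintype V] (G : SimpleGraph V),
        (∀ x, (Finset.univ.filter fun y => G.Adj x y).card ≤ D) →
      ∀ (Ω : Type*) [MeasurableSpace Ω] (P : Measure Ω) [IsProbabilityMeasure P]
        (w : G.edgeSet → Ω → ℝ) (ν : V → Ω → ℝ), IsDisorder P G ρE ρV w ν →
      ∀ (I : Finset (G.edgeSet ⊕ V)), I.card ≤ 2 → ∀ s : Finset V, s.card ≤ 4 →
      ∀ (R : ℕ) (X : Ω → ℝ≥0∞), AEMeasurable X P → (∀ ω, X ω ≤ 1) →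
        (∀ (ω : Ω) (n : ℕ) (b : ℝ), n + 1 ≤ R → 0 ≤ b →
          (∀ (w' : G.edgeSet → ℝ) (ν' : V → ℝ),
            (∀ i, i ∉ I → Sum.elim w' ν' i = Sum.elim w ν i ω) →
            ∀ x ∈ s, MonomerDecay (edgeActivity w' ν') n b x) →
          X ω ≤ ENNReal.ofReal (8 * b)) →
        ExpectationLE P X (C * Real.exp (-c * R)) := by
  -- `A` is the growth rate, per unit of `m`, of the number of choices in the union bound; `ε` is
  -- taken so small that A ε ≤ 1/2.
  set A : ℝ := D ^ (2 * (D + 2)) * 2 ^ (2 * (D + 2) * (2 * D + 1)) with hA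
  have hA0 : 0 ≤ A := by positivity
  set ε : ℝ := 1 / (2 * A + 2) with hε
  have hε0 : 0 < ε := by positivity
  have hε1 : ε ≤ 1 := by
    rw [hε, div_le_one (by positivity)]
    linarith
  have hAε : A * ε ≤ 1 / 2 := by
    rw [hε, mul_one_div, div_le_div_iff₀ (by positivity) two_pos]
    linarith
  obtain ⟨K₁, hK₁⟩ := exists_forall_measure_abs_gt_le ρE (ENNReal.ofReal_pos.2 hε0)
  obtain ⟨K₂, hK₂⟩ := exists_forall_measure_abs_gt_le ρV (ENNReal.ofReal_pos.2 hε0)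
  set K := max K₁ K₂
  set Λ : ℝ := D * Real.exp (3 * K) with hΛ
  have hΛ0 : 0 ≤ Λ := by positivity
  set L := Real.log (1 + Λ)
  have hL : 0 ≤ L := Real.log_nonneg (by linarith)
  set θ := Λ / (1 + Λ) with hθ
  have hθ0 : 0 ≤ θ := by positivity
  have hθ1 : θ < 1 := by
    rw [hθ, div_lt_one (by positivity)]
    linarith
  set η := max (1 / 2) θ
  have hη0 : 0 < η := lt_max_of_lt_left (by norm_num)
  have hη1 : η < 1 := max_lt (by norm_num) hθ1
  set B : ℝ := 2 ^ (2 * D + 1) / ε ^ 2 with hB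
  have hB0 : 0 ≤ B := by positivity
  have hq : 0 < 2 * (D + 2) := by omega
  -- The summand 1 serves R = 0, where only `X ≤ 1` is available. In the rest, 8L comes from the
  -- deterministic bound and 4B from the failure events at up to four vertices.
  refine ⟨-Real.log η / (2 * (D + 2) : ℕ), 1 + (8 * L + 4 * B) * η⁻¹,
    div_pos (neg_pos.2 (Real.log_neg hη0 hη1)) (by exact_mod_cast hq), by positivity, ?_⟩
  intro V _ G hD Ω _ P _ w ν hdis I hI s hs R X hX hX1 hbound
  refine ⟨hX, ?_⟩
  have hbad : ∀ i, P (Sum.elim w ν i ⁻¹' {r | K < |r|}) ≤ ENNReal.ofReal ε := by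
    have hmeas : MeasurableSet {r : ℝ | K < |r|} :=
      measurableSet_lt measurable_const measurable_norm
    rintro (e | x)
    · have h := hdis.law_edge e
      rw [Sum.elim_inl, ← Measure.map_apply_of_aemeasurable h.aemeasurable hmeas, h.map_eq]
      exact hK₁ K (le_max_left _ _)
    · have h := hdis.law_vertex x
      rw [Sum.elim_inr, ← Measure.map_apply_of_aemeasurable h.aemeasurable hmeas, h.map_eq]
      exact hK₂ K (le_max_right _ _)
  rcases Nat.eq_zero_or_pos R with rfl | hR
  · refine (lintegral_mono hX1).trans ?_
    rw [lintegral_const, measure_univ, mul_one, ← ENNReal.ofReal_one]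
    refine ENNReal.ofReal_le_ofReal ?_
    rw [Nat.cast_zero, mul_zero, Real.exp_zero, mul_one]
    have : 0 ≤ (8 * L + 4 * B) * η⁻¹ := by positivity
    linarith
  -- The walk length 2(D + 2)m is then at most R - 1, strictly below `R`.
  set m := (R - 1) / (2 * (D + 2)) with hm
  have hfail : ∀ x, P (failEvent (Sum.elim w ν) K I (2 * (D + 2) * m) (m - 2) x) ≤
      ENNReal.ofReal (B * (1 / 2) ^ m) := by
    intro x
    refine (measure_failEvent_le hD hdis.indep hbad I _ _ x).trans ?_
    rw [← ENNReal.ofReal_pow hε0.le, ← ENNReal.ofReal_natCast,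
      ← ENNReal.ofReal_mul (Nat.cast_nonneg _)]
    refine ENNReal.ofReal_le_ofReal ?_
    push_cast
    exact pow_mul_two_pow_mul_pow_le D (2 * (D + 2)) (2 * D + 1) m hε0 hε1 hAε
  set E := ⋃ x ∈ s, failEvent (Sum.elim w ν) K I (2 * (D + 2) * m) (m - 2) x with hE
  have hPE : P E ≤ ENNReal.ofReal (4 * (B * (1 / 2) ^ m)) := by
    refine (measure_biUnion_finset_le _ _).trans
      ((Finset.sum_le_card_nsmul _ _ _ fun x _ => hfail x).trans ?_)
    rw [nsmul_eq_mul, ← ENNReal.ofReal_natCast, ← ENNReal.ofReal_mul (Nat.cast_nonneg _)]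
    refine ENNReal.ofReal_le_ofReal (mul_le_mul_of_nonneg_right ?_ (by positivity))
    exact_mod_cast hs
  have hXle : ∀ ω, X ω ≤ ENNReal.ofReal (8 * (L * θ ^ m)) + E.indicator (fun _ => 1) ω := by
    intro ω
    by_cases hω : ω ∈ E
    · rw [Set.indicator_of_mem hω]
      exact (hX1 ω).trans le_add_self
    · refine le_add_of_le_left (hbound ω (2 * (D + 2) * m) _ ?_ (by positivity) ?_)
      · have := Nat.mul_div_le (R - 1) (2 * (D + 2))
        rw [← hm] at this
        omega
      · intro w' ν' h' x hx
        refine monomerDecay_of_notMem_failEvent hD hI ?_ h'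
        exact fun hf => hω (Set.mem_biUnion hx hf)
  refine (lintegral_mono hXle).trans ?_
  rw [lintegral_add_left measurable_const, lintegral_const, measure_univ, mul_one]
  refine (add_le_add_right ((lintegral_indicator_const_le _ _).trans_eq (one_mul _)) _).trans
    ((add_le_add_right hPE _).trans ?_)
  rw [← ENNReal.ofReal_add (by positivity) (by positivity)]
  refine ENNReal.ofReal_le_ofReal ?_
  have h1 : θ ^ m ≤ η ^ m := pow_le_pow_left₀ hθ0 (le_max_right _ _) m
  have h2 : (1 / 2 : ℝ) ^ m ≤ η ^ m := pow_le_pow_left₀ (by norm_num) (le_max_left _ _) m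
  have h3 := pow_div_le_exp hη0 hη1 hq R
  rw [← hm] at h3
  calc 8 * (L * θ ^ m) + 4 * (B * (1 / 2) ^ m)
      ≤ 8 * (L * η ^ m) + 4 * (B * η ^ m) := by gcongr
    _ = (8 * L + 4 * B) * η ^ m := by ring
    _ ≤ (8 * L + 4 * B) *
        (η⁻¹ * Real.exp (-(-Real.log η / (2 * (D + 2) : ℕ)) * R)) := by gcongr
    _ ≤ _ := by
      rw [← mul_assoc]
      refine mul_le_mul_of_nonneg_right ?_ (Real.exp_pos _).le
      linarith

/-- For infinite distance the bounds for all finite `R` tend to 0. -/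
theorem expectationLE_expDecay {Ω : Type*} [MeasurableSpace Ω] {P : Measure Ω} {X : Ω → ℝ≥0∞}
    {c C : ℝ} (hc : 0 < c) {d : ℕ∞}
    (h : ∀ R : ℕ, (R : ℕ∞) ≤ d → ExpectationLE P X (C * Real.exp (-c * R))) :
    ExpectationLE P X (C * expDecay c d) := by
  induction d using ENat.recTopCoe with
  | top =>
    refine ⟨(h 0 le_top).1, ?_⟩
    have h1 : Filter.Tendsto (fun R : ℕ => ENNReal.ofReal (C * Real.exp (-c * R))) Filter.atTop
        (nhds (ENNReal.ofReal (C * 0))) := by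
      refine ENNReal.tendsto_ofReal (Filter.Tendsto.const_mul C ?_)
      refine Real.tendsto_exp_atBot.comp ?_
      exact tendsto_natCast_atTop_atTop.const_mul_atTop_of_neg (neg_lt_zero.2 hc)
    exact ge_of_tendsto' h1 fun R => (h R le_top).2
  | coe n => exact h n le_rfl

end Expectation

/-! ### Measurability of suprema over two weights -/

section SupTwo

variable {ι κ Ω : Type*}

theorem continuous_swap_args {α β γ : Type*} [TopologicalSpace α] [TopologicalSpace β]
    [TopologicalSpace γ] {Φ : α → β → γ} (h : Continuous fun p : α × β => Φ p.1 p.2) :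
    Continuous fun p : β × α => Φ p.2 p.1 :=
  h.comp continuous_swap

theorem aemeasurable_ofReal_abs [Finite ι] [Finite κ] [MeasurableSpace Ω] {P : Measure Ω}
    {f : ι → Ω → ℝ} {g : κ → Ω → ℝ} (hf : ∀ i, AEMeasurable (f i) P)
    (hg : ∀ k, AEMeasurable (g k) P) {Φ : (ι → ℝ) → (κ → ℝ) → ℝ}
    (hΦ : Continuous fun p : (ι → ℝ) × (κ → ℝ) => Φ p.1 p.2) :
    AEMeasurable (fun ω => ENNReal.ofReal |Φ (f · ω) (g · ω)|) P := by
  have hpair : AEMeasurable (fun ω => ((f · ω), (g · ω))) P :=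
    (aemeasurable_pi_lambda _ hf).prodMk (aemeasurable_pi_lambda _ hg)
  exact (ENNReal.continuous_ofReal.comp (continuous_abs.comp hΦ)).measurable.comp_aemeasurable
    hpair

theorem supTwo_le {F : (ι → ℝ) → ℝ} {i j : ι} {u : ι → ℝ} {c : ℝ≥0∞}
    (h : ∀ v : ι → ℝ, (∀ k, k ≠ i → k ≠ j → v k = u k) → ENNReal.ofReal |F v| ≤ c) :
    supTwo F i j u ≤ c := by
  classical
  refine iSup_le fun s => iSup_le fun t => h _ fun k hi hj => ?_
  rw [Function.update_of_ne hj, Function.update_of_ne hi]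

theorem le_supTwo (F : (ι → ℝ) → ℝ) (i j : ι) (u : ι → ℝ) :
    ENNReal.ofReal |F u| ≤ supTwo F i j u := by
  classical
  refine le_iSup_of_le (u i) (le_iSup_of_le (u j) ?_)
  rw [Function.update_eq_self, Function.update_eq_self]

/-- The supremum is uncountable, but a supremum of continuous functions is lower semicontinuous,
hence Borel. -/
theorem aemeasurable_supTwo [Finite ι] [Finite κ] [MeasurableSpace Ω] {P : Measure Ω}
    {f : ι → Ω → ℝ} {g : κ → Ω → ℝ} (hf : ∀ i, AEMeasurable (f i) P)
    (hg : ∀ k, AEMeasurable (g k) P) {Φ : (ι → ℝ) → (κ → ℝ) → ℝ}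
    (hΦ : Continuous fun p : (ι → ℝ) × (κ → ℝ) => Φ p.1 p.2) (i j : ι) :
    AEMeasurable (fun ω => supTwo (fun u => Φ u (g · ω)) i j (f · ω)) P := by
  classical
  have hcont : ∀ s t : ℝ, Continuous fun p : (ι → ℝ) × (κ → ℝ) =>
      ENNReal.ofReal |Φ (Function.update (Function.update p.1 i s) j t) p.2| := by
    intro s t
    have h1 : Continuous fun p : (ι → ℝ) × (κ → ℝ) =>
        (Function.update (Function.update p.1 i s) j t, p.2) :=
      ((continuous_fst.update i continuous_const).update j continuous_const).prodMk continuous_snd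
    exact ENNReal.continuous_ofReal.comp (continuous_abs.comp (hΦ.comp h1))
  have hmeas : Measurable fun p : (ι → ℝ) × (κ → ℝ) =>
      ⨆ s : ℝ, ⨆ t : ℝ,
        ENNReal.ofReal |Φ (Function.update (Function.update p.1 i s) j t) p.2| :=
    (lowerSemicontinuous_iSup fun s => lowerSemicontinuous_iSup fun t =>
      (hcont s t).lowerSemicontinuous).measurable
  have hpair : AEMeasurable (fun ω => ((f · ω), (g · ω))) P :=
    (aemeasurable_pi_lambda _ hf).prodMk (aemeasurable_pi_lambda _ hg)
  refine (hmeas.comp_aemeasurable hpair).congr (ae_of_all _ fun ω => ?_)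
  simp only [Function.comp_apply]
  unfold supTwo
  congr! 4

end SupTwo

section Continuity

variable {V : Type*} [Fintype V] {G : SimpleGraph V}

theorem continuous_gibbsProb (H : G.Subgraph) (S : Set (Finset G.edgeSet)) :
    Continuous fun p : (G.edgeSet → ℝ) × (V → ℝ) => gibbsProb H p.1 p.2 S := by
  classical
  have h : ∀ e, Continuous fun p : (G.edgeSet → ℝ) × (V → ℝ) => edgeActivity p.1 p.2 e := by
    intro e
    unfold edgeActivity
    fun_prop
  have hprod : ∀ M : Finset G.edgeSet,
      Continuous fun p : (G.edgeSet → ℝ) × (V → ℝ) => ∏ e ∈ M, edgeActivity p.1 p.2 e :=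
    fun M => continuous_finsetProd _ fun e _ => h e
  simp only [gibbsProb_eq, matchingProb]
  refine Continuous.div ?_ ?_ fun p => (matchingSum_pos (edgeActivity_pos p.1 p.2) _).ne'
  · refine continuous_finsetSum _ fun M _ => ?_
    by_cases hM : M ∈ S
    · simpa only [Set.indicator_of_mem hM] using hprod M
    · simpa only [Set.indicator_of_notMem hM] using continuous_const
  · exact continuous_finsetSum _ fun M _ => hprod M

theorem continuous_edgeCov (e e' : G.edgeSet) :
    Continuous fun p : (G.edgeSet → ℝ) × (V → ℝ) => edgeCov e e' p.1 p.2 := by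
  simp only [edgeCov]
  exact (continuous_gibbsProb _ _).sub ((continuous_gibbsProb _ _).mul (continuous_gibbsProb _ _))

theorem continuous_vertexCov (x x' : V) :
    Continuous fun p : (G.edgeSet → ℝ) × (V → ℝ) => vertexCov x x' p.1 p.2 := by
  simp only [vertexCov]
  exact (continuous_gibbsProb _ _).sub ((continuous_gibbsProb _ _).mul (continuous_gibbsProb _ _))

end Continuity

end

end MonomerDimer

namespace MonomerDimer

/-! ### Distances, balls and local agreement -/

section Geometry

open scoped Classical

variable {V : Type*} {G : SimpleGraph V} {n : ℕ} {x : V}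

theorem edist_le_of_mem {f : G.edgeSet} {u z : V} (hu : u ∈ (f : Sym2 V))
    (hz : z ∈ (f : Sym2 V)) (h : G.edist x u < n) : G.edist x z ≤ n := by
  rcases eq_or_ne u z with rfl | hne
  · exact h.le
  · have huz : G.Adj u z := by
      have := f.2
      rwa [(Sym2.mem_and_mem_iff hne).1 ⟨hu, hz⟩, SimpleGraph.mem_edgeSet] at this
    calc G.edist x z ≤ G.edist x u + G.edist u z := SimpleGraph.edist_triangle
      _ = G.edist x u + 1 := by rw [SimpleGraph.edist_eq_one_iff_adj.2 huz]
      _ ≤ n := Order.add_one_le_of_lt h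

theorem locallyAgree_avoidVertex {F : Finset G.edgeSet} {z : V} (h : (n : ℕ∞) < G.edist x z) :
    LocallyAgree n x (avoidVertex F z) F := by
  rintro f ⟨u, hu, hd⟩
  rw [mem_avoidVertex, and_iff_left]
  exact fun hz => h.not_ge (edist_le_of_mem hu hz hd)

theorem locallyAgree_avoidEdge {F : Finset G.edgeSet} {e : G.edgeSet}
    (h : ∀ z ∈ (e : Sym2 V), (n : ℕ∞) < G.edist x z) :
    LocallyAgree n x (avoidEdge F e) F := by
  rintro f ⟨u, hu, hd⟩
  rw [mem_avoidEdge, and_iff_left]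
  exact fun z hz hzf => (h z hz).not_ge (edist_le_of_mem hu hzf hd)

theorem edgeDist_le {e f : G.edgeSet} {y : V} (hx : x ∈ (e : Sym2 V)) (hy : y ∈ (f : Sym2 V)) :
    edgeDist e f ≤ G.edist x y :=
  iInf₂_le_of_le x hx (iInf₂_le y hy)

variable [Fintype V]

theorem mem_edgesOf_top (f : G.edgeSet) : f ∈ edgesOf (⊤ : G.Subgraph) := by
  rw [mem_edgesOf, SimpleGraph.Subgraph.edgeSet_top]
  exact f.2

theorem mem_edgesOf_of_induce_le {H : G.Subgraph} {T : Set V}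
    (hT : (⊤ : G.Subgraph).induce T ≤ H) {f : G.edgeSet} (hf : ∀ z ∈ (f : Sym2 V), z ∈ T) :
    f ∈ edgesOf H := by
  rw [mem_edgesOf]
  refine SimpleGraph.Subgraph.edgeSet_mono hT ?_
  obtain ⟨f, hfG⟩ := f
  induction f with
  | h a b =>
    rw [SimpleGraph.Subgraph.mem_edgeSet, SimpleGraph.Subgraph.induce_adj]
    exact ⟨hf a (Sym2.mem_mk_left a b), hf b (Sym2.mem_mk_right a b), hfG⟩

/-- An edge with an endpoint at distance less than `n` has both endpoints within `n`, so an induced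
ball of radius `n` contains it. -/
theorem locallyAgree_of_induce_le {H : G.Subgraph} {T : Set V}
    (hT : (⊤ : G.Subgraph).induce T ≤ H) (h : ∀ z, G.edist x z ≤ n → z ∈ T) :
    LocallyAgree n x (edgesOf ⊤) (edgesOf H) := by
  rintro f ⟨u, hu, hd⟩
  refine iff_of_true (mem_edgesOf_top f) (mem_edgesOf_of_induce_le hT fun z hz => ?_)
  exact h z (edist_le_of_mem hu hz hd)

end Geometry

/-! ### Deterministic bounds for the covariances and the local approximations -/

section Bounds

open scoped Classical

variable {V : Type*} [Fintype V] {G : SimpleGraph V} {n R : ℕ} {b : ℝ} {w : G.edgeSet → ℝ}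
  {ν : V → ℝ}

theorem abs_edgeCov_le_one (e e' : G.edgeSet) (w : G.edgeSet → ℝ) (ν : V → ℝ) :
    |edgeCov e e' w ν| ≤ 1 := by
  rw [edgeCov, gibbsProb_eq, gibbsProb_eq, gibbsProb_eq]
  exact abs_matchingProb_cov_le_one (edgeActivity_pos w ν) _ {M | e ∈ M} {M | e' ∈ M}

theorem abs_vertexCov_le_one (x x' : V) (w : G.edgeSet → ℝ) (ν : V → ℝ) :
    |vertexCov x x' w ν| ≤ 1 := by
  rw [vertexCov, gibbsProb_eq, gibbsProb_eq, gibbsProb_eq]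
  exact abs_matchingProb_cov_le_one (edgeActivity_pos w ν) _ {M | Unmatched x M}
    {M | Unmatched x' M}

theorem abs_gibbsProb_sub_le_one (H H' : G.Subgraph) (w : G.edgeSet → ℝ) (ν : V → ℝ)
    (S : Set (Finset G.edgeSet)) : |gibbsProb H w ν S - gibbsProb H' w ν S| ≤ 1 := by
  rw [gibbsProb_eq, gibbsProb_eq]
  exact abs_matchingProb_sub_le_one (edgeActivity_pos w ν) _ _ S

theorem abs_edgeCov_le {e e' : G.edgeSet} (hn : (n : ℕ∞) < edgeDist e e')
    (hdec : ∀ x ∈ (e' : Sym2 V), MonomerDecay (edgeActivity w ν) n b x) :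
    |edgeCov e e' w ν| ≤ 2 * b := by
  have hlt : ∀ x ∈ (e' : Sym2 V), ∀ z ∈ (e : Sym2 V), (n : ℕ∞) < G.edist x z := by
    intro x hx z hz
    rw [SimpleGraph.edist_comm]
    exact hn.trans_le (edgeDist_le hz hx)
  rw [edgeCov, gibbsProb_eq, gibbsProb_eq, gibbsProb_eq]
  refine abs_matchingProb_mem_cov_le (edgeActivity_pos w ν) (mem_edgesOf_top e)
    (mem_avoidEdge.2 ⟨mem_edgesOf_top e', fun z hz hz' => ?_⟩) hdec
    fun x hx => locallyAgree_avoidEdge (hlt x hx)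
  -- A common endpoint would be at distance 0 from itself, so the edges are disjoint.
  have := hlt z hz' z hz
  rw [SimpleGraph.edist_self] at this
  exact not_lt_zero this

theorem abs_vertexCov_le {x x' : V} (hn : (n : ℕ∞) < G.edist x x')
    (hdec : MonomerDecay (edgeActivity w ν) n b x') : |vertexCov x x' w ν| ≤ b := by
  rw [vertexCov, gibbsProb_eq, gibbsProb_eq, gibbsProb_eq]
  refine abs_matchingProb_unmatched_cov_le (edgeActivity_pos w ν) hdec
    (locallyAgree_avoidVertex ?_)
  rwa [SimpleGraph.edist_comm]

theorem abs_gibbsProb_edgeEvent_sub_le {e e' : G.edgeSet} {H : G.Subgraph} (hn : n ≤ R)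
    (hH : edgeBall e R ⊔ edgeBall e' R ≤ H)
    (hdec : ∀ x, x ∈ (e : Sym2 V) ∨ x ∈ (e' : Sym2 V) → MonomerDecay (edgeActivity w ν) n b x)
    (δ₁ δ₂ : Bool) :
    |gibbsProb (⊤ : G.Subgraph) w ν (edgeEvent e e' δ₁ δ₂) -
      gibbsProb H w ν (edgeEvent e e' δ₁ δ₂)| ≤ 8 * b := by
  have hball : ∀ f : G.edgeSet, edgeBall f R ≤ H → f ∈ edgesOf H ∧
      ∀ x ∈ (f : Sym2 V), LocallyAgree n x (edgesOf ⊤) (edgesOf H) := by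
    intro f hf
    refine ⟨mem_edgesOf_of_induce_le hf fun z hz => ⟨z, hz, ?_⟩, fun x hx =>
      locallyAgree_of_induce_le hf fun z hz => ⟨x, hx, hz.trans (by exact_mod_cast hn)⟩⟩
    rw [SimpleGraph.edist_self]
    exact zero_le
  obtain ⟨heH, he⟩ := hball e (le_sup_left.trans hH)
  obtain ⟨heH', he'⟩ := hball e' (le_sup_right.trans hH)
  have ha := edgeActivity_pos w ν
  rw [gibbsProb_eq, gibbsProb_eq]
  -- Each single edge contributes 2b and the joint event 4b.
  refine (abs_matchingProb_event_sub_le ha {M | e ∈ M} {M | e' ∈ M} δ₁ δ₂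
    (abs_matchingProb_mem_sub_le ha (fun x hx => hdec x (Or.inl hx)) he (mem_edgesOf_top e) heH)
    (abs_matchingProb_mem_sub_le ha (fun x hx => hdec x (Or.inr hx)) he' (mem_edgesOf_top e') heH')
    (abs_matchingProb_mem_inter_sub_le ha (mem_edgesOf_top e) heH (mem_edgesOf_top e') heH' hdec
      fun x hx => hx.elim (he x) (he' x))).trans_eq ?_
  ring

theorem abs_gibbsProb_vertexEvent_sub_le {x x' : V} {H : G.Subgraph} (hn : n ≤ R)
    (hH : vertexBall x R ⊔ vertexBall x' R ≤ H)
    (hx : MonomerDecay (edgeActivity w ν) n b x) (hx' : MonomerDecay (edgeActivity w ν) n b x')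
    (δ₁ δ₂ : Bool) :
    |gibbsProb (⊤ : G.Subgraph) w ν (vertexEvent x x' δ₁ δ₂) -
      gibbsProb H w ν (vertexEvent x x' δ₁ δ₂)| ≤ 4 * b := by
  have hball : ∀ y : V, vertexBall y R ≤ H → LocallyAgree n y (edgesOf ⊤) (edgesOf H) :=
    fun y hy => locallyAgree_of_induce_le hy fun z hz => hz.trans (by exact_mod_cast hn)
  have h := hball x (le_sup_left.trans hH)
  have h' := hball x' (le_sup_right.trans hH)
  have ha := edgeActivity_pos w ν
  have hmono : ∀ y, MonomerDecay (edgeActivity w ν) n b y →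
      LocallyAgree n y (edgesOf ⊤) (edgesOf H) →
      |matchingProb (edgeActivity w ν) (edgesOf ⊤) {M | Unmatched y M} -
        matchingProb (edgeActivity w ν) (edgesOf H) {M | Unmatched y M}| ≤ b := by
    intro y hy hyH
    rw [matchingProb_unmatched, matchingProb_unmatched]
    exact abs_monomerProb_sub_le ha hy hyH
  rw [gibbsProb_eq, gibbsProb_eq]
  refine (abs_matchingProb_event_sub_le ha {M | Unmatched x M} {M | Unmatched x' M} δ₁ δ₂
    (hmono x hx h) (hmono x' hx' h')
    (abs_matchingProb_unmatched_inter_sub_le ha hx hx' h h')).trans_eq ?_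
  ring

theorem ofReal_abs_le_one {r : ℝ} (h : |r| ≤ 1) : ENNReal.ofReal |r| ≤ 1 :=
  ENNReal.ofReal_one ▸ ENNReal.ofReal_le_ofReal h

theorem card_filter_mem_le_two (e : G.edgeSet) :
    (Finset.univ.filter fun x : V => x ∈ (e : Sym2 V)).card ≤ 2 := by
  obtain ⟨x, y, hxy⟩ : ∃ x y, (e : Sym2 V) = s(x, y) :=
    ⟨_, _, (Quot.out_eq (e : Sym2 V)).symm⟩
  have h : (Finset.univ.filter fun v : V => v ∈ (e : Sym2 V)) ⊆ {x, y} := by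
    intro v hv
    simpa [hxy] using hv
  exact (Finset.card_le_card h).trans Finset.card_le_two

end Bounds

end MonomerDimer

-- `exists_expectationLE_exp` is applied with `I` the two weights under the supremum and `s` the
-- vertices where decay is needed: those of the second object for a covariance, those of both for a
-- local approximation.
open scoped Classical in
open MonomerDimer in
theorem MonomerDimer.exists_correlation_bounds (D : ℕ) (ρE ρV : Measure ℝ)
    [IsProbabilityMeasure ρE] [IsProbabilityMeasure ρV] :
    ∃ c C : ℝ, 0 < c ∧ 0 < C ∧
      ∀ (V : Type*) [Fintype V] (G : SimpleGraph V),
        (∀ x, (Finset.univ.filter fun y => G.Adj x y).card ≤ D) →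
      ∀ (Ω : Type*) [MeasurableSpace Ω] (P : Measure Ω) [IsProbabilityMeasure P]
        (w : G.edgeSet → Ω → ℝ) (ν : V → Ω → ℝ), IsDisorder P G ρE ρV w ν →
      (∀ e e' : G.edgeSet,
        ExpectationLE P (fun ω => supTwo (fun u => edgeCov e e' u (ν · ω)) e e' (w · ω))
          (C * expDecay c (edgeDist e e'))) ∧
      (∀ x x' : V,
        ExpectationLE P (fun ω => supTwo (fun u => vertexCov x x' (w · ω) u) x x' (ν · ω))
          (C * expDecay c (G.edist x x'))) ∧
      (∀ (R : ℕ) (e e' : G.edgeSet) (H : G.Subgraph),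
        edgeBall e R ⊔ edgeBall e' R ≤ H → ∀ δ₁ δ₂ : Bool,
        ExpectationLE P
          (fun ω => supTwo (fun u =>
            gibbsProb (⊤ : G.Subgraph) u (ν · ω) (edgeEvent e e' δ₁ δ₂) -
              gibbsProb H u (ν · ω) (edgeEvent e e' δ₁ δ₂)) e e' (w · ω))
          (C * Real.exp (-c * R))) ∧
      (∀ (R : ℕ) (x x' : V) (H : G.Subgraph),
        vertexBall x R ⊔ vertexBall x' R ≤ H → ∀ δ₁ δ₂ : Bool,
        ExpectationLE P
          (fun ω => supTwo (fun u =>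
            gibbsProb (⊤ : G.Subgraph) (w · ω) u (vertexEvent x x' δ₁ δ₂) -
              gibbsProb H (w · ω) u (vertexEvent x x' δ₁ δ₂)) x x' (ν · ω))
          (C * Real.exp (-c * R))) := by
  obtain ⟨c, C, hc, hC, key⟩ := exists_expectationLE_exp D ρE ρV
  refine ⟨c, C, hc, hC, ?_⟩
  intro V _ G hD Ω _ P _ w ν hdis
  have hkey := key V G hD Ω P w ν hdis
  have hw : ∀ e, AEMeasurable (w e) P := fun e => (hdis.law_edge e).aemeasurable
  have hν : ∀ x, AEMeasurable (ν x) P := fun x => (hdis.law_vertex x).aemeasurable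
  have hI : ∀ i j : G.edgeSet ⊕ V, ({i, j} : Finset (G.edgeSet ⊕ V)).card ≤ 2 := fun _ _ =>
    Finset.card_le_two
  have hagreeE : ∀ (ω : Ω) (e e' : G.edgeSet) (v : G.edgeSet → ℝ),
      (∀ k, k ≠ e → k ≠ e' → v k = w k ω) →
      ∀ i, i ∉ ({Sum.inl e, Sum.inl e'} : Finset (G.edgeSet ⊕ V)) →
        Sum.elim v (ν · ω) i = Sum.elim w ν i ω := by
    rintro ω e e' v hv (k | k) hk
    · simp only [Finset.mem_insert, Finset.mem_singleton, Sum.inl.injEq, not_or] at hk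
      exact hv k hk.1 hk.2
    · rfl
  have hagreeV : ∀ (ω : Ω) (x x' : V) (v : V → ℝ),
      (∀ k, k ≠ x → k ≠ x' → v k = ν k ω) →
      ∀ i, i ∉ ({Sum.inr x, Sum.inr x'} : Finset (G.edgeSet ⊕ V)) →
        Sum.elim (w · ω) v i = Sum.elim w ν i ω := by
    rintro ω x x' v hv (k | k) hk
    · rfl
    · simp only [Finset.mem_insert, Finset.mem_singleton, Sum.inr.injEq, not_or] at hk
      exact hv k hk.1 hk.2
  refine ⟨fun e e' => expectationLE_expDecay hc fun R hR => ?_,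
    fun x x' => expectationLE_expDecay hc fun R hR => ?_,
    fun R e e' H hH δ₁ δ₂ => ?_, fun R x x' H hH δ₁ δ₂ => ?_⟩
  · refine hkey {Sum.inl e, Sum.inl e'} (hI _ _)
      (Finset.univ.filter fun x : V => x ∈ (e' : Sym2 V))
      ((card_filter_mem_le_two e').trans (by norm_num)) R _ ?_ ?_ ?_
    · exact aemeasurable_supTwo hw hν (continuous_edgeCov e e') e e'
    · exact fun ω => supTwo_le fun v _ => ofReal_abs_le_one (abs_edgeCov_le_one e e' v _)
    · intro ω n b hn hb hdec
      refine supTwo_le fun v hv => ENNReal.ofReal_le_ofReal ?_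
      refine (abs_edgeCov_le (b := b) (lt_of_lt_of_le ?_ hR) fun x hx =>
        hdec v _ (hagreeE ω e e' v hv) x (by simpa using hx)).trans (by linarith)
      exact_mod_cast hn
  · refine hkey {Sum.inr x, Sum.inr x'} (hI _ _) {x'} (by simp) R _ ?_ ?_ ?_
    · exact aemeasurable_supTwo hν hw (Φ := fun u v => vertexCov x x' v u)
        (continuous_swap_args (continuous_vertexCov x x')) x x'
    · exact fun ω => supTwo_le fun v _ => ofReal_abs_le_one (abs_vertexCov_le_one x x' _ v)
    · intro ω n b hn hb hdec
      refine supTwo_le fun v hv => ENNReal.ofReal_le_ofReal ?_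
      refine (abs_vertexCov_le (b := b) (lt_of_lt_of_le ?_ hR)
        (hdec _ v (hagreeV ω x x' v hv) x' (by simp))).trans (by linarith)
      exact_mod_cast hn
  · refine hkey {Sum.inl e, Sum.inl e'} (hI _ _)
      ((Finset.univ.filter fun x : V => x ∈ (e : Sym2 V)) ∪
        Finset.univ.filter fun x : V => x ∈ (e' : Sym2 V))
      ((Finset.card_union_le _ _).trans
        (add_le_add (card_filter_mem_le_two e) (card_filter_mem_le_two e'))) R _ ?_ ?_ ?_
    · exact aemeasurable_supTwo hw hν (Φ := fun u v =>
        gibbsProb (⊤ : G.Subgraph) u v (edgeEvent e e' δ₁ δ₂) -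
          gibbsProb H u v (edgeEvent e e' δ₁ δ₂))
        ((continuous_gibbsProb _ _).sub (continuous_gibbsProb _ _)) e e'
    · exact fun ω => supTwo_le fun v _ => ofReal_abs_le_one (abs_gibbsProb_sub_le_one _ _ v _ _)
    · intro ω n b hn hb hdec
      refine supTwo_le fun v hv => ENNReal.ofReal_le_ofReal ?_
      exact abs_gibbsProb_edgeEvent_sub_le (by omega) hH (fun x hx =>
        hdec v _ (hagreeE ω e e' v hv) x (by simpa using hx)) δ₁ δ₂
  · refine hkey {Sum.inr x, Sum.inr x'} (hI _ _) {x, x'}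
      (Finset.card_le_two.trans (by norm_num)) R _ ?_ ?_ ?_
    · exact aemeasurable_supTwo hν hw (Φ := fun u v =>
        gibbsProb (⊤ : G.Subgraph) v u (vertexEvent x x' δ₁ δ₂) -
          gibbsProb H v u (vertexEvent x x' δ₁ δ₂))
        (continuous_swap_args (Φ := fun u v => gibbsProb (⊤ : G.Subgraph) u v
          (vertexEvent x x' δ₁ δ₂) - gibbsProb H u v (vertexEvent x x' δ₁ δ₂))
          ((continuous_gibbsProb _ _).sub (continuous_gibbsProb _ _))) x x'
    · exact fun ω => supTwo_le fun v _ => ofReal_abs_le_one (abs_gibbsProb_sub_le_one _ _ _ v _)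
    · intro ω n b hn hb hdec
      refine supTwo_le fun v hv => ENNReal.ofReal_le_ofReal ?_
      have h := hdec _ v (hagreeV ω x x' v hv)
      exact (abs_gibbsProb_vertexEvent_sub_le (by omega) hH (h x (by simp)) (h x' (by simp))
        δ₁ δ₂).trans (by linarith)

theorem mainTheorem6 (D : ℕ) (ρE ρV : Measure ℝ) [IsProbabilityMeasure ρE]
    [IsProbabilityMeasure ρV] :
    ∃ c C : ℝ, 0 < c ∧ 0 < C ∧
      ∀ (V : Type*) [Fintype V] (G : SimpleGraph V) [DecidableRel G.Adj],
        (∀ x, G.degree x ≤ D) →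
      ∀ (Ω : Type*) [MeasurableSpace Ω] (P : Measure Ω) [IsProbabilityMeasure P]
        (w : G.edgeSet → Ω → ℝ) (ν : V → Ω → ℝ),
        MonomerDimer.IsDisorder P G ρE ρV w ν →
      -- decay of the edge-edge covariance
      (∀ e e' : G.edgeSet,
        MonomerDimer.ExpectationLE P
          (fun ω => ENNReal.ofReal |MonomerDimer.edgeCov e e' (w · ω) (ν · ω)|)
          (C * MonomerDimer.expDecay c (MonomerDimer.edgeDist e e'))) ∧
      -- the same, with the supremum over the two edge weights inside the expectation
      (∀ e e' : G.edgeSet,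
        MonomerDimer.ExpectationLE P
          (fun ω => MonomerDimer.supTwo
            (fun u => MonomerDimer.edgeCov e e' u (ν · ω)) e e' (w · ω))
          (C * MonomerDimer.expDecay c (MonomerDimer.edgeDist e e'))) ∧
      -- decay of the vertex-vertex covariance, with the supremum over the two vertex weights
      (∀ x x' : V,
        MonomerDimer.ExpectationLE P
          (fun ω => MonomerDimer.supTwo
            (fun u => MonomerDimer.vertexCov x x' (w · ω) u) x x' (ν · ω))
          (C * MonomerDimer.expDecay c (G.edist x x'))) ∧
      -- local approximation of the joint law of two edge indicators
      (∀ (R : ℕ), 1 ≤ R → ∀ (e e' : G.edgeSet) (H : G.Subgraph),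
        MonomerDimer.edgeBall e R ⊔ MonomerDimer.edgeBall e' R ≤ H → ∀ δ₁ δ₂ : Bool,
        MonomerDimer.ExpectationLE P
          (fun ω => MonomerDimer.supTwo
            (fun u =>
              MonomerDimer.gibbsProb (⊤ : G.Subgraph) u (ν · ω)
                  (MonomerDimer.edgeEvent e e' δ₁ δ₂) -
                MonomerDimer.gibbsProb H u (ν · ω)
                  (MonomerDimer.edgeEvent e e' δ₁ δ₂)) e e' (w · ω))
          (C * Real.exp (-c * R))) ∧
      -- local approximation of the joint law of two vertex indicators
      (∀ (R : ℕ), 1 ≤ R → ∀ (x x' : V) (H : G.Subgraph),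
        MonomerDimer.vertexBall x R ⊔ MonomerDimer.vertexBall x' R ≤ H → ∀ δ₁ δ₂ : Bool,
        MonomerDimer.ExpectationLE P
          (fun ω => MonomerDimer.supTwo
            (fun u =>
              MonomerDimer.gibbsProb (⊤ : G.Subgraph) (w · ω) u
                  (MonomerDimer.vertexEvent x x' δ₁ δ₂) -
                MonomerDimer.gibbsProb H (w · ω) u
                  (MonomerDimer.vertexEvent x x' δ₁ δ₂)) x x' (ν · ω))
          (C * Real.exp (-c * R))) := by
  obtain ⟨c, C, hc, hC, key⟩ := MonomerDimer.exists_correlation_bounds D ρE ρV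
  refine ⟨c, C, hc, hC, ?_⟩
  intro V _ G _ hdeg Ω _ P _ w ν hdis
  obtain ⟨h1, h2, h3, h4⟩ := key V G (fun x => by
    refine le_trans (le_of_eq ?_) (hdeg x)
    rw [← SimpleGraph.card_neighborFinset_eq_degree, SimpleGraph.neighborFinset_eq_filter]
    congr!) Ω P w ν hdis
  -- The actual weights compete in the supremum, so the plain covariance bound follows from the one
  -- with the supremum.
  refine ⟨fun e e' => ⟨?_, (lintegral_mono fun ω => ?_).trans (h1 e e').2⟩, h1, h2,
    fun R _ => h3 R, fun R _ => h4 R⟩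
  · exact MonomerDimer.aemeasurable_ofReal_abs (fun e => (hdis.law_edge e).aemeasurable)
      (fun x => (hdis.law_vertex x).aemeasurable) (MonomerDimer.continuous_edgeCov e e')
  · exact MonomerDimer.le_supTwo (fun u => MonomerDimer.edgeCov e e' u (ν · ω)) e e' (w · ω)
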